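/- Conventions. $r\ge 2$ and $n\ge 1$ are integers, powers $w^s$ use the principal branch $-\pi<\arg w\le\pi$, $(X)_k=X(X+1)\cdots(X+k-1)$ (with $(X)_0=1$), and in the series below terms with vanishing base $w=0$ are omitted. For $z\in\mathbb{C}$ put, for $\Re s>r$, $$H_r(s,z)=\sum_{m\in\mathbb{Z}}\frac{m^{r-1}}{(m+z)^s},\qquad K_r(s,z)=\frac{1}{(r-1)!}\sum_{m\in\mathbb{Z}}\frac{(m+1)_{r-1}}{(m+z)^s},\qquad \zeta_r(s,z)=\sum_{m_1,\dots,m_r\ge 0}\frac{1}{(m_1+\cdots+m_r+z)^s}.$$ (1) Let $\Im z>0$ or $z\in\mathbb{R}$, $-1<z<1$. The series $H_r(s,z)$ converges absolutely for $\Re s>r$ and continues to an entire function of $s$. Define the generalized primitive multiple sine function by $$\mathscr{S}_{r,1}(z)=\exp\Bigl(-\frac{\partial H_r}{\partial s}(0,z)\Bigr),$$ and the (Hölder–Kurokawa) primitive multiple sine function by the convergent product $$\mathscr{S}_r(z)=\exp\Bigl(\frac{z^{r-1}}{r-1}\Bigr)\prod_{m=1}^\infty\Bigl(P_r\bigl(\tfrac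 zm\bigr)P_r\bigl(-\tfrac zm\bigr)^{(-1)^{r-1}}\Bigr)^{m^{r-1}},\qquad P_r(u)=(1-u)\exp\Bigl(\sum_{j=1}^r\frac{u^j}{j}\Bigr).$$ Then, with the Riemann zeta function $\zeta$, $$\mathscr{S}_{r,1}(z)=\exp\Bigl(-\frac{(r-1)!}{(2\pi i)^{r-1}}\zeta(r)+(-1)^{r-1}\pi i\frac{z^r}{r}\Bigr)\,\mathscr{S}_r(z)^{(-1)^{r-1}}.$$ (2) Let $\Im z>0$, or $z\in\mathbb{R}$, $0<z<r$, or $n>1$ and $z=0$. The series $K_r(s,z)$, $\zeta_r(s,z)$, $\zeta_r(s,r-z)$ converge absolutely for $\Re s>r$; $K_r(s,z)$ continues to an entire function of $s$, and $\zeta_r(s,z)$, $\zeta_r(s,r-z)$ continue holomorphically to $s\in\mathbb{C}\setminus\{1,\dots,r\}$. Define the generalized normalized multiple sine function and the Kurokawa–Wakayama normalized multiple sine function by $$\mathcal{S}_{r,n}(z)=\exp\Bigl(-\frac{\partial K_r}{\partial s}(1-n,z)\Bigr),\qquad S_{r,n}(z)=\exp\Bigl(-\frac{\partial\zeta_r}{\partial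 s}(1-n,z)+(-1)^{r+n-1}\frac{\partial\zeta_r}{\partial s}(1-n,r-z)\Bigr).$$ Then $$\mathcal{S}_{r,n}(z)=\exp\Bigl((-1)^{r-1}\pi i\,\frac{(n-1)!}{(r+n-1)!}B_{r,r+n-1}(z)\Bigr)\,S_{r,n}(z),$$ where the multiple Bernoulli polynomials $B_{r,k}(z)$ are defined by $\dfrac{t^re^{zt}}{(e^t-1)^r}=\sum_{k\ge 0}B_{r,k}(z)\dfrac{t^k}{k!}$. -/

import Mathlib

/-- `F` is a holomorphic continuation to the set `U` of the function `f`, which is given on the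
half-plane `σ < Re s`. -/
def IsHolomorphicContinuation (f : ℂ → ℂ) (σ : ℝ) (U : Set ℂ) (F : ℂ → ℂ) : Prop :=
  DifferentiableOn ℂ F U ∧ ∀ s : ℂ, σ < s.re → F s = f s

/-- On an open connected set containing the half-plane, the continuation is unique. -/
theorem IsHolomorphicContinuation.eqOn {f : ℂ → ℂ} {σ : ℝ} {U : Set ℂ} {F G : ℂ → ℂ}
    (hU : IsOpen U) (hc : IsPreconnected U) (hσ : {s : ℂ | σ < s.re} ⊆ U)
    (hF : IsHolomorphicContinuation f σ U F) (hG : IsHolomorphicContinuation f σ U G) :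
    Set.EqOn F G U := by
  have h1 : ((σ + 1 : ℝ) : ℂ) ∈ {s : ℂ | σ < s.re} := by simp
  have hop : IsOpen {s : ℂ | σ < s.re} := isOpen_lt continuous_const Complex.continuous_re
  refine (hF.1.analyticOnNhd hU).eqOn_of_preconnected_of_eventuallyEq
    (hG.1.analyticOnNhd hU) hc (hσ h1) ?_
  filter_upwards [hop.mem_nhds h1] with s hs
  rw [hF.2 s hs, hG.2 s hs]

open Classical in
/-- The holomorphic continuation to `U` of a function `f` given on the half-plane `σ < Re s`
(the zero function if there is none). -/
noncomputable def holomorphicContinuation (f : ℂ → ℂ) (σ : ℝ) (U : Set ℂ) : ℂ → ℂ :=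
  if h : ∃ F, IsHolomorphicContinuation f σ U F then h.choose else 0

/-- The term `m ^ (r - 1) / (m + z) ^ s` of the bilateral series `H_r(s, z)`. Powers are taken with
the principal branch of the argument; the quotient is `0` when `m + z = 0` (and `s ≠ 0`). -/
noncomputable def bilateralHTerm (r : ℕ) (z s : ℂ) (m : ℤ) : ℂ :=
  (m : ℂ) ^ (r - 1) / ((m : ℂ) + z) ^ s

/-- The series `H_r(s, z)`, for `Re s > r`. -/
noncomputable def bilateralHSeries (r : ℕ) (z s : ℂ) : ℂ :=
  ∑' m : ℤ, bilateralHTerm r z s m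

/-- The entire function `s ↦ H_r(s, z)`. -/
noncomputable def bilateralH (r : ℕ) (z : ℂ) : ℂ → ℂ :=
  holomorphicContinuation (bilateralHSeries r z) r Set.univ

/-- The term `(m + 1)_{r - 1} / ((r - 1)! (m + z) ^ s)` of the bilateral series `K_r(s, z)`, where
`(X)_k` is the rising factorial. It is `0` when `m + z = 0` (and `s ≠ 0`). -/
noncomputable def bilateralKTerm (r : ℕ) (z s : ℂ) (m : ℤ) : ℂ :=
  1 / ((r - 1).factorial : ℂ) *
    ((ascPochhammer ℂ (r - 1)).eval ((m : ℂ) + 1) / ((m : ℂ) + z) ^ s)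

/-- The series `K_r(s, z)`, for `Re s > r`. -/
noncomputable def bilateralKSeries (r : ℕ) (z s : ℂ) : ℂ :=
  ∑' m : ℤ, bilateralKTerm r z s m

/-- The entire function `s ↦ K_r(s, z)`. -/
noncomputable def bilateralK (r : ℕ) (z : ℂ) : ℂ → ℂ :=
  holomorphicContinuation (bilateralKSeries r z) r Set.univ

/-- The generalized primitive multiple sine function `exp (-∂H_r/∂s (1 - n, z))`. -/
noncomputable def genPrimitiveSine (r n : ℕ) (z : ℂ) : ℂ :=
  Complex.exp (-deriv (bilateralH r z) (1 - n))

/-- The generalized normalized multiple sine function `exp (-∂K_r/∂s (1 - n, z))`. -/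
noncomputable def genNormalizedSine (r n : ℕ) (z : ℂ) : ℂ :=
  Complex.exp (-deriv (bilateralK r z) (1 - n))

/-- `P_r(u) = (1 - u) exp (u + u² / 2 + ⋯ + u ^ r / r)`. -/
noncomputable def primaryFactor (r : ℕ) (u : ℂ) : ℂ :=
  (1 - u) * Complex.exp (∑ j ∈ Finset.Icc 1 r, u ^ j / (j : ℂ))

/-- The factor `(P_r(z / m) P_r(-z / m) ^ ((-1) ^ (r - 1))) ^ (m ^ (r - 1))`. -/
noncomputable def primitiveSineFactor (r : ℕ) (z : ℂ) (m : ℕ) : ℂ :=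
  (primaryFactor r (z / m) * primaryFactor r (-z / m) ^ ((-1 : ℤ) ^ (r - 1))) ^ (m ^ (r - 1))

/-- The primitive multiple sine function of Hölder and Kurokawa, for `r ≥ 2`; the product runs over
`m = 1, 2, 3, …`. -/
noncomputable def primitiveSine (r : ℕ) (z : ℂ) : ℂ :=
  Complex.exp (z ^ (r - 1) / ((r : ℂ) - 1)) * ∏' m : ℕ, primitiveSineFactor r z (m + 1)

/-- The term `(m₁ + ⋯ + m_r + z) ^ (-s)` of the multiple Hurwitz zeta function, with the principal
branch. It is `0` when `m₁ + ⋯ + m_r + z = 0` (and `s ≠ 0`). -/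
noncomputable def multipleHurwitzTerm (r : ℕ) (z s : ℂ) (m : Fin r → ℕ) : ℂ :=
  1 / ((∑ i, (m i : ℂ)) + z) ^ s

/-- The multiple Hurwitz series, for `Re s > r`. -/
noncomputable def multipleHurwitzSeries (r : ℕ) (z s : ℂ) : ℂ :=
  ∑' m : Fin r → ℕ, multipleHurwitzTerm r z s m

/-- The plane without the points `1, …, r`, the possible poles of `ζ_r(s, z)`. -/
def multipleHurwitzDomain (r : ℕ) : Set ℂ :=
  {s : ℂ | ∀ j ∈ Finset.Icc 1 r, s ≠ (j : ℂ)}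

/-- The multiple Hurwitz zeta function `s ↦ ζ_r(s, z)`. -/
noncomputable def multipleHurwitz (r : ℕ) (z : ℂ) : ℂ → ℂ :=
  holomorphicContinuation (multipleHurwitzSeries r z) r (multipleHurwitzDomain r)

/-- The normalized multiple sine function `S_{r,n}(z)` of Kurokawa and Wakayama. -/
noncomputable def normalizedSine (r n : ℕ) (z : ℂ) : ℂ :=
  Complex.exp (-deriv (multipleHurwitz r z) (1 - n)
    + (-1) ^ (r + n - 1) * deriv (multipleHurwitz r (r - z)) (1 - n))

/-- The power series `(e ^ t - 1) / t` in the variable `t`. -/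
noncomputable def expSubOneDivSeries : PowerSeries ℂ :=
  PowerSeries.mk fun k => 1 / ((k + 1).factorial : ℂ)

/-- The multiple Bernoulli polynomial `B_{r,k}(z)`: `k!` times the coefficient of `t ^ k` in
`t ^ r e ^ {z t} / (e ^ t - 1) ^ r`. -/
noncomputable def multipleBernoulli (r k : ℕ) (z : ℂ) : ℂ :=
  (k.factorial : ℂ) *
    PowerSeries.coeff k (expSubOneDivSeries⁻¹ ^ r * PowerSeries.rescale z (PowerSeries.exp ℂ))

/-- The generating function identity of the multiple Bernoulli polynomials. -/
theorem multipleBernoulli_generating (r : ℕ) (z : ℂ) :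
    (PowerSeries.exp ℂ - 1) ^ r
        * PowerSeries.mk (fun k => multipleBernoulli r k z / (k.factorial : ℂ))
      = PowerSeries.X ^ r * PowerSeries.rescale z (PowerSeries.exp ℂ) := by
  have h0 : PowerSeries.constantCoeff expSubOneDivSeries ≠ 0 := by
    simp [expSubOneDivSeries]
  have h1 : PowerSeries.exp ℂ - 1 = PowerSeries.X * expSubOneDivSeries := by
    ext k
    cases k with
    | zero => simp
    | succ k =>
      rw [PowerSeries.coeff_succ_X_mul]
      simp [expSubOneDivSeries, PowerSeries.coeff_exp, PowerSeries.coeff_one]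
  have h2 : PowerSeries.mk (fun k => multipleBernoulli r k z / (k.factorial : ℂ))
      = expSubOneDivSeries⁻¹ ^ r * PowerSeries.rescale z (PowerSeries.exp ℂ) := by
    ext k
    rw [PowerSeries.coeff_mk, multipleBernoulli,
      mul_div_cancel_left₀ _ (by exact_mod_cast k.factorial_ne_zero)]
  rw [h1, h2, mul_pow, mul_assoc, ← mul_assoc (expSubOneDivSeries ^ r), ← mul_pow,
    PowerSeries.mul_inv_cancel _ h0, one_pow, one_mul]

/-!
Both identities rest on explicit continuations in `s`, obtained from the Riemann zeta function.

For large `k`, the power `(k + a) ^ (-s)` has the binomial expansion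
`∑ j, binom (-s, j) a ^ j k ^ (-s - j)`. Subtracting its first `N` terms from the moment series
`∑ k ^ i (k + a) ^ (-s)` leaves a series that converges locally uniformly for `i + 1 - N < Re s`
(`differentiableAt_momentRemainder`), while the sums over `k` of the subtracted terms are
`binom (-s, j) a ^ j ζ (s + j - i)`. Letting `N` grow continues the moment series to the
plane without `1, …, i + 1` (`hurwitzMoment`). In the combination of the moments at `a` and `-a` with the factor
`(-1) ^ i exp (-π i s)`, the zeta values appear only through the entire function
`ζ (1 + t) (1 - exp (-π i t))` (`twistedZeta`), so this combination is entire (`bilateralMoment`).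
With `i = r - 1` it is `H_r`; linear combinations with the coefficients of
`(X + 1)_{r - 1} / (r - 1)!`, together with the term `k = 0`, give `ζ_r` and `K_r`.

*Primitive sine functions.* At `s = 0` all terms are explicit. The derivative of the remainder with
`N = r + 1` is, up to sign, the sum of logarithms of the powers of the primary factors
`P_r (± z / k)` (`exp_neg_deriv_momentTerm_zero`). Among the zeta terms only three survive, because
of the trivial zeros and the zeros of `1 - exp (-π i t)`: up to sign, `j = r - 1` gives
`z ^ (r - 1) / (r - 1)`, `j = r` gives `π i z ^ r / r`, and `j = 0` gives, by the functional
equation, the constant with `ζ (r)` (`hasDerivAt_twistedZeta_neg_natCast`).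

*Normalized sine functions.* The weights vanish at `-1, …, -(r - 1)` and are symmetric up to sign
about `-r / 2`, so `K_r(s, z) = ζ_r(s, z) + (-1) ^ (r - 1) exp (-π i s) ζ_r(s, r - z)`
(`eqOn_bilateralKCont`). Differentiating at `s = 1 - n`, the exponential factor contributes the
value `ζ_r(1 - n, r - z)`, a multiple of `B_{r, r + n - 1}(r - z)`
(`zetaCont_one_sub_natCast_eq_bernoulli`): value and multiple Bernoulli polynomial are polynomials
in the parameter with the same differences (by induction on `r`), so they differ by a constant for
each `n`, and as they satisfy the same derivative relation in `n`, the constants vanish.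
-/

open Filter Topology

/-! ### Powers and the binomial series -/

/-- The power `w ^ (-s)`, with the value `0` at `w = 0` for every `s`. Unlike `w ^ (-s)`, this is
an entire function of `s` for every `w`. -/
noncomputable def negCpow (w s : ℂ) : ℂ := if w = 0 then 0 else w ^ (-s)

lemma negCpow_of_ne_zero {w : ℂ} (hw : w ≠ 0) (s : ℂ) : negCpow w s = w ^ (-s) := if_neg hw

lemma one_div_cpow_eq_negCpow (w : ℂ) {s : ℂ} (hs : s ≠ 0) : 1 / w ^ s = negCpow w s := by
  by_cases hw : w = 0
  · simp [negCpow, hw, Complex.zero_cpow hs]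
  · rw [negCpow_of_ne_zero hw, Complex.cpow_neg, one_div]

lemma differentiable_negCpow (w : ℂ) : Differentiable ℂ (negCpow w) := by
  by_cases hw : w = 0
  · have : negCpow w = fun _ => 0 := by funext s; simp [negCpow, hw]
    rw [this]; exact differentiable_const _
  · have : negCpow w = fun s => w ^ (-s) := by funext s; simp [negCpow, hw]
    rw [this]
    exact differentiable_id.neg.const_cpow (Or.inl hw)

lemma hasDerivAt_negCpow_zero {w : ℂ} (hw : w ≠ 0) :
    HasDerivAt (negCpow w) (-Complex.log w) 0 := by
  have h : negCpow w = fun s => w ^ (-s) := by funext s; simp [negCpow, hw]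
  rw [h]
  simpa using (hasDerivAt_id (0 : ℂ)).neg.const_cpow (c := w) (Or.inl hw)

lemma negCpow_one_sub_natCast {w : ℂ} {n : ℕ} (hn : 1 ≤ n) (hw : w ≠ 0) :
    negCpow w (1 - n) = w ^ (n - 1) := by
  rw [negCpow_of_ne_zero hw, ← Complex.cpow_natCast]
  congr 1
  push_cast [hn]
  ring

/-- The binomial coefficient `binom (-s, j)`, as a function of `s`. -/
noncomputable def binomNeg (j : ℕ) (s : ℂ) : ℂ :=
  (∏ l ∈ Finset.range j, (-s - l)) / (j.factorial : ℂ)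

@[simp] lemma binomNeg_zero (s : ℂ) : binomNeg 0 s = 1 := by simp [binomNeg]

lemma binomNeg_eq_choose (j : ℕ) (s : ℂ) : binomNeg j s = Ring.choose (-s) j := by
  have h : ∀ j, (descPochhammer ℤ j).smeval (-s) = ∏ l ∈ Finset.range j, (-s - l) := by
    intro j
    induction j with
    | zero => simp
    | succ j ih =>
      rw [descPochhammer_succ_right, Polynomial.smeval_mul, ih, Finset.prod_range_succ]
      simp [Polynomial.smeval_natCast]
  rw [binomNeg, Ring.choose_eq_smul, h, smul_eq_mul, div_eq_inv_mul]

lemma differentiable_binomNeg (j : ℕ) : Differentiable ℂ (binomNeg j) := by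
  unfold binomNeg
  fun_prop

lemma binomNeg_eq_zero {j m : ℕ} (h : m < j) : binomNeg j (-m) = 0 := by
  rw [binomNeg, Finset.prod_eq_zero (Finset.mem_range.2 h) (by simp), zero_div]

lemma binomNeg_succ_left (j : ℕ) (s : ℂ) :
    (j + 1 : ℂ) * binomNeg (j + 1) s = -s * binomNeg j (s + 1) := by
  have h : (j.factorial : ℂ) ≠ 0 := by exact_mod_cast j.factorial_ne_zero
  have h' : (j + 1 : ℂ) ≠ 0 := by exact_mod_cast j.succ_ne_zero
  rw [binomNeg, binomNeg, Finset.prod_range_succ', Nat.factorial_succ]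
  have : ∏ l ∈ Finset.range j, (-s - ((l + 1 : ℕ) : ℂ))
      = ∏ l ∈ Finset.range j, (-(s + 1) - (l : ℂ)) :=
    Finset.prod_congr rfl fun l _ => by push_cast; ring
  rw [this]
  push_cast
  field_simp
  ring

lemma hasDerivAt_binomNeg_zero {j : ℕ} (hj : 1 ≤ j) :
    HasDerivAt (binomNeg j) ((-1) ^ j / j) 0 := by
  obtain ⟨m, rfl⟩ : ∃ m, j = m + 1 := ⟨j - 1, by omega⟩
  have hm : (m + 1 : ℂ) ≠ 0 := by exact_mod_cast m.succ_ne_zero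
  have h1 : binomNeg (m + 1) = fun s => -s * binomNeg m (s + 1) / (m + 1 : ℂ) := by
    funext s
    rw [← binomNeg_succ_left, mul_div_cancel_left₀ _ hm]
  have h2 : binomNeg m 1 = (-1) ^ m := by
    rw [binomNeg, div_eq_iff (by exact_mod_cast m.factorial_ne_zero)]
    have : ∀ l ∈ Finset.range m, (-1 - l : ℂ) = (-1) * (l + 1 : ℕ) := fun l _ => by
      push_cast; ring
    rw [Finset.prod_congr rfl this, Finset.prod_mul_distrib, Finset.prod_const,
      Finset.card_range, ← Nat.cast_prod, Finset.prod_range_add_one_eq_factorial]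
  have h3 : DifferentiableAt ℂ (fun s => binomNeg m (s + 1)) 0 :=
    ((differentiable_binomNeg m).comp (differentiable_id.add_const 1)).differentiableAt
  rw [h1]
  have h4 := ((hasDerivAt_id (0 : ℂ)).neg.mul h3.hasDerivAt).div_const (m + 1 : ℂ)
  simp only [Pi.neg_apply, id, zero_add, h2, neg_zero, zero_mul, add_zero] at h4
  convert! h4 using 1
  push_cast
  ring

lemma norm_binomNeg_le (j : ℕ) {s : ℂ} {ρ : ℝ} (hs : ‖s‖ ≤ ρ) :
    ‖binomNeg j s‖ ≤ ‖binomNeg j ρ‖ := by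
  have hρ : 0 ≤ ρ := (norm_nonneg s).trans hs
  simp only [binomNeg, norm_div, norm_prod]
  gcongr with l _
  have h : ‖(-(ρ : ℂ) - l)‖ = ρ + l := by
    rw [show (-(ρ : ℂ) - l) = -((ρ + l : ℝ) : ℂ) by push_cast; ring, norm_neg,
      Complex.norm_of_nonneg (by positivity)]
  rw [h]
  calc ‖-s - l‖ ≤ ‖-s‖ + ‖(l : ℂ)‖ := norm_sub_le _ _
    _ ≤ ρ + l := by simpa using hs

lemma hasSum_binomNeg (s : ℂ) {w : ℂ} (hw : ‖w‖ < 1) :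
    HasSum (fun j => binomNeg j s * w ^ j) ((1 + w) ^ (-s)) := by
  have h := (Complex.one_add_cpow_hasFPowerSeriesOnBall_zero (a := -s)).hasSum (y := w)
    (by rw [← ENNReal.ofReal_one, Metric.eball_ofReal]; simpa using hw)
  simpa only [binomialSeries_apply, ← binomNeg_eq_choose, List.ofFn_const, List.prod_replicate,
    smul_eq_mul, zero_add] using h

lemma summable_norm_binomNeg (s : ℂ) : Summable fun j => ‖binomNeg j s‖ * (1 / 2 : ℝ) ^ j := by
  have h := (hasSum_binomNeg s (w := ((1 / 2 : ℝ) : ℂ)) (by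
    rw [Complex.norm_real]; norm_num)).summable.norm
  refine h.congr fun j => ?_
  rw [norm_mul, norm_pow, Complex.norm_real]
  norm_num

/-- The remainder of the binomial series after `N` terms, bounded uniformly for `s` in a disc. -/
lemma exists_norm_one_add_cpow_sub_le (ρ : ℝ) (N : ℕ) :
    ∃ C, 0 ≤ C ∧ ∀ s w : ℂ, ‖s‖ ≤ ρ → ‖w‖ ≤ 1 / 2 →
      ‖(1 + w) ^ (-s) - ∑ j ∈ Finset.range N, binomNeg j s * w ^ j‖ ≤ C * ‖w‖ ^ N := by
  have hsum : Summable fun j => ‖binomNeg (j + N) ρ‖ * (1 / 2 : ℝ) ^ j := by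
    have h := ((summable_nat_add_iff N).2 (summable_norm_binomNeg (ρ : ℂ))).mul_left (2 ^ N)
    refine h.congr fun j => ?_
    rw [pow_add, one_div, inv_pow, inv_pow]
    field_simp
  refine ⟨∑' j, ‖binomNeg (j + N) ρ‖ * (1 / 2 : ℝ) ^ j, tsum_nonneg fun j => by positivity,
    fun s w hs hw => ?_⟩
  have h1 := (hasSum_nat_add_iff' N).2 (hasSum_binomNeg s (w := w) (by linarith))
  rw [← h1.tsum_eq, ← tsum_mul_right]
  refine tsum_of_norm_bounded (hsum.mul_right _).hasSum fun j => ?_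
  rw [norm_mul, norm_pow, pow_add, ← mul_assoc]
  gcongr
  exact norm_binomNeg_le _ hs

/-! ### Remainders of moment series -/

lemma natCast_add_one_ne_zero (k : ℕ) : (k + 1 : ℂ) ≠ 0 := by exact_mod_cast k.succ_ne_zero

/-- The term, for the integer `k + 1`, of the series `∑ k ^ i (k + a) ^ (-s)` after subtraction of
the first `N` terms of the binomial expansion of `(k + a) ^ (-s)` in powers of `a / k`. -/
noncomputable def momentTerm (i : ℕ) (a : ℂ) (N : ℕ) (s : ℂ) (k : ℕ) : ℂ :=
  (k + 1 : ℂ) ^ i * (negCpow (k + 1 + a) s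
    - ∑ j ∈ Finset.range N, binomNeg j s * a ^ j * (k + 1 : ℂ) ^ (-s - j))

/-- The sum of `momentTerm`, which converges for `i + 1 - N < Re s`. For `N = 0` it is the moment
series `∑ k ^ i (k + a) ^ (-s)` over `k ≥ 1`. -/
noncomputable def momentRemainder (i : ℕ) (a : ℂ) (N : ℕ) (s : ℂ) : ℂ :=
  ∑' k, momentTerm i a N s k

lemma differentiable_momentTerm (i : ℕ) (a : ℂ) (N k : ℕ) :
    Differentiable ℂ fun s => momentTerm i a N s k := by
  unfold momentTerm
  refine (Differentiable.sub (differentiable_negCpow _) ?_).const_mul _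
  refine Differentiable.fun_sum fun j _ => ?_
  refine ((differentiable_binomNeg j).mul_const _).mul ?_
  exact (differentiable_id.neg.sub_const _).const_cpow (Or.inl (natCast_add_one_ne_zero k))

lemma norm_momentTerm_le_of_two_mul_norm_le (i : ℕ) (a : ℂ) (N : ℕ) (ρ : ℝ) :
    ∃ C, 0 ≤ C ∧ ∀ (s : ℂ) (k : ℕ), ‖s‖ ≤ ρ → 2 * ‖a‖ ≤ k + 1 →
      ‖momentTerm i a N s k‖ ≤ C * (k + 1 : ℝ) ^ (i - s.re - N) := by
  obtain ⟨C, hC, h⟩ := exists_norm_one_add_cpow_sub_le ρ N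
  refine ⟨C * ‖a‖ ^ N, by positivity, fun s k hs hk => ?_⟩
  have hk0 : (0 : ℝ) < k + 1 := by positivity
  have hkc : ((k + 1 : ℝ) : ℂ) = k + 1 := by push_cast; ring
  have hw : ‖a / (k + 1)‖ ≤ 1 / 2 := by
    rw [norm_div, ← hkc, Complex.norm_of_nonneg hk0.le, div_le_iff₀ hk0]
    linarith
  have hw0 : 1 + a / (k + 1) ≠ 0 := by
    intro h0
    have : a / (k + 1) = -1 := by linear_combination h0
    rw [this] at hw
    norm_num at hw
  have hfac : (k + 1 + a : ℂ) = ((k + 1 : ℝ) : ℂ) * (1 + a / (k + 1)) := by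
    rw [hkc, mul_add, mul_div_cancel₀ _ (natCast_add_one_ne_zero k), mul_one]
  have hne : (k + 1 + a : ℂ) ≠ 0 := by
    rw [hfac]
    exact mul_ne_zero (hkc ▸ natCast_add_one_ne_zero k) hw0
  have hpow : negCpow (k + 1 + a) s = (k + 1 : ℂ) ^ (-s) * (1 + a / (k + 1)) ^ (-s) := by
    rw [negCpow_of_ne_zero hne, Complex.cpow_def_of_ne_zero hne,
      Complex.cpow_def_of_ne_zero (natCast_add_one_ne_zero k), Complex.cpow_def_of_ne_zero hw0,
      ← Complex.exp_add, hfac, Complex.log_ofReal_mul hk0 hw0, Complex.ofReal_log hk0.le, hkc]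
    congr 1
    ring
  have hterm : momentTerm i a N s k = (k + 1 : ℂ) ^ i * ((k + 1 : ℂ) ^ (-s)
      * ((1 + a / (k + 1)) ^ (-s)
        - ∑ j ∈ Finset.range N, binomNeg j s * (a / (k + 1)) ^ j)) := by
    rw [momentTerm, hpow, mul_sub ((k + 1 : ℂ) ^ (-s)), Finset.mul_sum]
    refine congrArg (fun x => (k + 1 : ℂ) ^ i * (_ - x)) (Finset.sum_congr rfl fun j _ => ?_)
    rw [Complex.cpow_sub _ _ (natCast_add_one_ne_zero k), Complex.cpow_natCast, div_pow]
    ring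
  rw [hterm, norm_mul, norm_mul, norm_pow, ← hkc,
    Complex.norm_cpow_eq_rpow_re_of_pos hk0, Complex.norm_of_nonneg hk0.le]
  have hb := h s (a / ((k + 1 : ℝ) : ℂ)) hs (by rwa [hkc])
  rw [norm_div, Complex.norm_of_nonneg hk0.le, div_pow] at hb
  calc (k + 1 : ℝ) ^ i * ((k + 1 : ℝ) ^ (-s).re * _)
      ≤ (k + 1 : ℝ) ^ i * ((k + 1 : ℝ) ^ (-s).re * (C * (‖a‖ ^ N / (k + 1 : ℝ) ^ N))) := by gcongr
    _ = C * ‖a‖ ^ N * (k + 1 : ℝ) ^ (i - s.re - N) := by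
      rw [Real.rpow_sub hk0, Real.rpow_sub hk0, Real.rpow_natCast, Real.rpow_natCast,
        Complex.neg_re, Real.rpow_neg hk0.le]
      field_simp

/-- Locally uniform summability of the remainder terms in the half-plane `i + 1 - N < Re s`. -/
lemma exists_summable_norm_momentTerm_le (i : ℕ) (a : ℂ) (N : ℕ) (ρ σ : ℝ)
    (hσ : i + 1 - N < σ) :
    ∃ u : ℕ → ℝ, Summable u ∧ ∀ (k : ℕ) (s : ℂ), ‖s‖ ≤ ρ → σ ≤ s.re →
      ‖momentTerm i a N s k‖ ≤ u k := by
  obtain ⟨C, hC, h⟩ := norm_momentTerm_le_of_two_mul_norm_le i a N ρ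
  have hM : ∀ k, ∃ M, ∀ s ∈ Metric.closedBall (0 : ℂ) ρ, ‖momentTerm i a N s k‖ ≤ M := fun k =>
    (isCompact_closedBall (0 : ℂ) ρ).exists_bound_of_continuousOn
      (differentiable_momentTerm i a N k).continuous.continuousOn
  choose M hM using hM
  -- the finitely many terms with `k + 1 < 2 ‖a‖` are bounded by compactness of the disc only
  refine ⟨fun k => if 2 * ‖a‖ ≤ k + 1 then C * (k + 1 : ℝ) ^ (i - σ - N) else M k, ?_, ?_⟩
  · have h1 : Summable fun k : ℕ => C * (k + 1 : ℝ) ^ (i - σ - N) := by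
      refine Summable.mul_left _ ?_
      have := (summable_nat_add_iff 1).2
        (Real.summable_nat_rpow.2 (show (i : ℝ) - σ - N < -1 by linarith))
      simpa using this
    refine (summable_congr_cofinite ?_).2 h1
    rw [Nat.cofinite_eq_atTop]
    filter_upwards [Filter.eventually_ge_atTop ⌈2 * ‖a‖⌉₊] with k hk
    rw [if_pos]
    exact (Nat.le_ceil _).trans (by exact_mod_cast hk.trans k.le_succ)
  · intro k s hs hre
    beta_reduce
    split_ifs with hk
    · refine (h s k hs hk).trans ?_
      gcongr
      linarith [(k.cast_nonneg : (0 : ℝ) ≤ k)]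
    · exact hM k s (by simpa using hs)

lemma summable_norm_momentTerm (i : ℕ) (a : ℂ) (N : ℕ) {s : ℂ} (hs : (i : ℝ) + 1 - N < s.re) :
    Summable fun k => ‖momentTerm i a N s k‖ := by
  obtain ⟨u, hu, h⟩ := exists_summable_norm_momentTerm_le i a N ‖s‖ s.re hs
  exact Summable.of_nonneg_of_le (fun _ => norm_nonneg _) (fun k => h k s le_rfl le_rfl) hu

lemma hasSum_momentRemainder (i : ℕ) (a : ℂ) (N : ℕ) {s : ℂ} (hs : (i : ℝ) + 1 - N < s.re) :
    HasSum (momentTerm i a N s) (momentRemainder i a N s) :=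
  (summable_norm_momentTerm i a N hs).of_norm.hasSum

/-- A neighbourhood of a point of the half-plane on which the remainder converges uniformly. -/
lemma exists_isOpen_momentTerm_le (i : ℕ) (a : ℂ) (N : ℕ) {s : ℂ}
    (hs : (i : ℝ) + 1 - N < s.re) :
    ∃ U : Set ℂ, IsOpen U ∧ s ∈ U ∧ ∃ u : ℕ → ℝ, Summable u ∧
      ∀ (k : ℕ), ∀ w ∈ U, ‖momentTerm i a N w k‖ ≤ u k := by
  obtain ⟨σ, h1, h2⟩ := exists_between hs
  obtain ⟨u, hu, h⟩ := exists_summable_norm_momentTerm_le i a N (‖s‖ + 1) σ h1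
  refine ⟨{w | ‖w‖ < ‖s‖ + 1} ∩ {w | σ < w.re}, ?_, ⟨by simp, h2⟩, u, hu, ?_⟩
  · exact (isOpen_lt continuous_norm continuous_const).inter
      (isOpen_lt continuous_const Complex.continuous_re)
  · exact fun k w hw => h k w (le_of_lt hw.1) (le_of_lt hw.2)

lemma differentiableAt_momentRemainder (i : ℕ) (a : ℂ) (N : ℕ) {s : ℂ}
    (hs : (i : ℝ) + 1 - N < s.re) : DifferentiableAt ℂ (momentRemainder i a N) s := by
  obtain ⟨U, hU, hsU, u, hu, h⟩ := exists_isOpen_momentTerm_le i a N hs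
  exact (Complex.differentiableOn_tsum_of_summable_norm hu
    (fun k => (differentiable_momentTerm i a N k).differentiableOn) hU h).differentiableAt
    (hU.mem_nhds hsU)

lemma hasSum_deriv_momentRemainder (i : ℕ) (a : ℂ) (N : ℕ) {s : ℂ}
    (hs : (i : ℝ) + 1 - N < s.re) :
    HasSum (fun k => deriv (fun w => momentTerm i a N w k) s)
      (deriv (momentRemainder i a N) s) := by
  obtain ⟨U, hU, hsU, u, hu, h⟩ := exists_isOpen_momentTerm_le i a N hs
  exact Complex.hasSum_deriv_of_summable_norm hu
    (fun k => (differentiable_momentTerm i a N k).differentiableOn) hU h hsU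

/-- Passing from `N` to `N + 1` splits off a value of the Riemann zeta function. -/
lemma momentRemainder_eq_add_succ (i : ℕ) (a : ℂ) (N : ℕ) {s : ℂ}
    (hs : (i : ℝ) + 1 - N < s.re) :
    momentRemainder i a N s = binomNeg N s * a ^ N * riemannZeta (s + N - i)
      + momentRemainder i a (N + 1) s := by
  have hre : 1 < (s + N - i).re := by simp; linarith
  have hz : HasSum (fun k : ℕ => 1 / (k + 1 : ℂ) ^ (s + N - i)) (riemannZeta (s + N - i)) := by
    rw [zeta_eq_tsum_one_div_nat_add_one_cpow hre]
    have := (summable_nat_add_iff 1).2 (Complex.summable_one_div_nat_cpow.2 hre)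
    simpa using this.hasSum
  have h1 := (hz.mul_left (binomNeg N s * a ^ N)).add
    (hasSum_momentRemainder i a (N + 1) (s := s) (by push_cast; linarith))
  refine ((hasSum_momentRemainder i a N hs).unique ?_)
  convert! h1 using 1
  funext k
  have hk := natCast_add_one_ne_zero k
  have : 1 / (k + 1 : ℂ) ^ (s + N - i) = (k + 1 : ℂ) ^ i * (k + 1 : ℂ) ^ (-s - N) := by
    rw [one_div, ← Complex.cpow_neg, ← Complex.cpow_natCast, ← Complex.cpow_add _ _ hk]
    congr 1
    ring
  rw [this, momentTerm, momentTerm, Finset.sum_range_succ]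
  ring

/-- At the nonpositive integers the binomial expansion is finite, and its remainders vanish. -/
lemma momentTerm_one_sub_natCast (i : ℕ) {a : ℂ} {k n N : ℕ} (ha : (k + 1 : ℂ) + a ≠ 0)
    (hn : 1 ≤ n) (hN : n ≤ N) : momentTerm i a N (1 - n) k = 0 := by
  obtain ⟨m, rfl⟩ : ∃ m, n = m + 1 := ⟨n - 1, by omega⟩
  have hk := natCast_add_one_ne_zero k
  have h1 : ∑ j ∈ Finset.range N, binomNeg j (1 - (m + 1 : ℕ)) * a ^ j
        * (k + 1 : ℂ) ^ (-(1 - ((m + 1 : ℕ) : ℂ)) - j)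
      = ∑ j ∈ Finset.range (m + 1), binomNeg j (1 - (m + 1 : ℕ)) * a ^ j
        * (k + 1 : ℂ) ^ (-(1 - ((m + 1 : ℕ) : ℂ)) - j) := by
    symm
    refine Finset.sum_subset (by simpa using hN) fun j _ hj => ?_
    have hmj : m < j := by simpa using hj
    rw [show (1 - ((m + 1 : ℕ) : ℂ)) = -m by push_cast; ring, binomNeg_eq_zero hmj]
    simp
  have h2 : ∀ j ∈ Finset.range (m + 1), binomNeg j (1 - (m + 1 : ℕ)) * a ^ j
        * (k + 1 : ℂ) ^ (-(1 - ((m + 1 : ℕ) : ℂ)) - j)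
      = a ^ j * (k + 1 : ℂ) ^ (m - j) * (m.choose j : ℂ) := by
    intro j hj
    have hmj : j ≤ m := by simpa [Nat.lt_succ_iff] using hj
    rw [binomNeg_eq_choose, show -(1 - ((m + 1 : ℕ) : ℂ)) = (m : ℂ) by push_cast; ring,
      Ring.choose_natCast, ← Nat.cast_sub hmj, Complex.cpow_natCast]
    ring
  rw [momentTerm, negCpow_one_sub_natCast hn ha, h1, Finset.sum_congr rfl h2, ← add_pow,
    Nat.add_sub_cancel, add_comm a, sub_self, mul_zero]

lemma momentRemainder_one_sub_natCast (i : ℕ) {a : ℂ} (ha : ∀ k : ℕ, (k + 1 : ℂ) + a ≠ 0)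
    {n N : ℕ} (hn : 1 ≤ n) (hN : n ≤ N) : momentRemainder i a N (1 - n) = 0 := by
  simp [momentRemainder, momentTerm_one_sub_natCast i (ha _) hn hN]

/-- The derivative of a remainder term at `s = 0` is a logarithm of the power of a primary
factor. -/
lemma exp_neg_deriv_momentTerm_zero (i : ℕ) {a : ℂ} {k : ℕ} (ha : (k + 1 : ℂ) + a ≠ 0) (r : ℕ) :
    Complex.exp (-deriv (fun s => momentTerm i a (r + 1) s k) 0)
      = primaryFactor r (-a / (k + 1)) ^ (k + 1) ^ i := by
  have hk := natCast_add_one_ne_zero k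
  have hcp : ∀ j : ℕ, HasDerivAt (fun s : ℂ => (k + 1 : ℂ) ^ (-s - j))
      ((k + 1 : ℂ) ^ (-(0 : ℂ) - j) * Complex.log (k + 1) * -1) 0 := fun j =>
    ((hasDerivAt_id (0 : ℂ)).neg.sub_const (j : ℂ)).const_cpow (c := (k + 1 : ℂ)) (Or.inl hk)
  have h0 : HasDerivAt (fun s : ℂ => binomNeg 0 s * a ^ 0 * (k + 1 : ℂ) ^ (-s - (0 : ℕ)))
      (-Complex.log (k + 1)) 0 := by
    simpa using hcp 0
  have hj : ∀ j ∈ Finset.range r, HasDerivAt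
      (fun s : ℂ => binomNeg (j + 1) s * a ^ (j + 1) * (k + 1 : ℂ) ^ (-s - (j + 1 : ℕ)))
      ((-a / (k + 1)) ^ (j + 1) / ((j + 1 : ℕ) : ℂ)) 0 := by
    intro j _
    have hz : binomNeg (j + 1) 0 = 0 := by simpa using binomNeg_eq_zero (Nat.succ_pos j)
    convert! ((hasDerivAt_binomNeg_zero (Nat.succ_pos j)).mul_const (a ^ (j + 1))).mul
      (hcp (j + 1)) using 1
    rw [hz, neg_zero, zero_sub, Complex.cpow_neg, Complex.cpow_natCast, neg_div, neg_pow, div_pow]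
    field_simp
    simp [mul_comm]
  have hd := ((hasDerivAt_negCpow_zero ha).sub
    ((HasDerivAt.fun_sum hj).add h0)).const_mul ((k + 1 : ℂ) ^ i)
  have hd' : deriv (fun s => momentTerm i a (r + 1) s k) 0 = (k + 1 : ℂ) ^ i *
      (-Complex.log (k + 1 + a) - (∑ j ∈ Finset.range r,
        (-a / (k + 1)) ^ (j + 1) / ((j + 1 : ℕ) : ℂ) + -Complex.log (k + 1))) := by
    rw [← hd.deriv]
    congr 1
    funext s
    simp only [momentTerm, Finset.sum_range_succ' _ r, Pi.sub_apply, Pi.add_apply]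
  have hu : 1 - -a / (k + 1 : ℂ) = Complex.exp (Complex.log (k + 1 + a) - Complex.log (k + 1)) := by
    rw [Complex.exp_sub, Complex.exp_log ha, Complex.exp_log hk]
    field_simp
    ring
  have hS : ∑ j ∈ Finset.Icc 1 r, (-a / (k + 1 : ℂ)) ^ j / (j : ℂ)
      = ∑ j ∈ Finset.range r, (-a / (k + 1 : ℂ)) ^ (j + 1) / ((j + 1 : ℕ) : ℂ) := by
    rw [← Finset.Ico_add_one_right_eq_Icc, Finset.sum_Ico_eq_sum_range]
    simp only [Nat.add_sub_cancel, add_comm 1]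
  rw [hd', primaryFactor, hu, hS, ← Complex.exp_add, ← Complex.exp_nat_mul]
  congr 1
  push_cast
  ring

/-! ### Continuation of moment series -/

/-- The function `g s * ζ (s - c + 1)`, with the value `g' c` at the pole `s = c` of the zeta
factor. This is the continuous extension when `g c = 0`. -/
noncomputable def zetaReg (g : ℂ → ℂ) (c : ℂ) : ℂ → ℂ :=
  Function.update (fun s => g s * riemannZeta (s - c + 1)) c (deriv g c)

lemma zetaReg_of_ne (g : ℂ → ℂ) {c s : ℂ} (h : s ≠ c) :
    zetaReg g c s = g s * riemannZeta (s - c + 1) := Function.update_of_ne h _ _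

lemma zetaReg_self (g : ℂ → ℂ) (c : ℂ) : zetaReg g c c = deriv g c := Function.update_self _ _ _

lemma differentiableAt_zetaReg_of_ne {g : ℂ → ℂ} (hg : Differentiable ℂ g) {c s : ℂ} (h : s ≠ c) :
    DifferentiableAt ℂ (zetaReg g c) s := by
  have h1 : DifferentiableAt ℂ (fun s => g s * riemannZeta (s - c + 1)) s := by
    refine hg.differentiableAt.mul ?_
    refine (differentiableAt_riemannZeta ?_).comp s
      ((differentiable_id.sub_const c).add_const 1).differentiableAt
    simpa [sub_eq_zero] using h
  refine h1.congr_of_eventuallyEq ?_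
  filter_upwards [isOpen_ne.mem_nhds h] with w hw using zetaReg_of_ne g hw

lemma tendsto_sub_mul_riemannZeta (c : ℂ) :
    Tendsto (fun s => (s - c) * riemannZeta (s - c + 1)) (𝓝[≠] c) (𝓝 1) := by
  have h : Tendsto (fun s : ℂ => s - c + 1) (𝓝[≠] c) (𝓝[≠] 1) := by
    refine tendsto_nhdsWithin_iff.2 ⟨?_, ?_⟩
    · have : ContinuousAt (fun s : ℂ => s - c + 1) c := by fun_prop
      simpa [ContinuousAt] using this.tendsto.mono_left nhdsWithin_le_nhds
    · filter_upwards [self_mem_nhdsWithin] with s hs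
      simpa [sub_eq_zero] using hs
  simpa [Function.comp_def] using riemannZeta_residue_one.comp h

lemma differentiable_zetaReg {g : ℂ → ℂ} (hg : Differentiable ℂ g) {c : ℂ} (hc : g c = 0) :
    Differentiable ℂ (zetaReg g c) := by
  intro s
  rcases ne_or_eq s c with h | rfl
  · exact differentiableAt_zetaReg_of_ne hg h
  refine AnalyticAt.differentiableAt
    (Complex.analyticAt_of_differentiable_on_punctured_nhds_of_continuousAt ?_ ?_)
  · filter_upwards [self_mem_nhdsWithin] with w hw using differentiableAt_zetaReg_of_ne hg hw
  · refine continuousAt_update_same.2 ?_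
    have h := (hasDerivAt_iff_tendsto_slope.1 (hg s).hasDerivAt).mul (tendsto_sub_mul_riemannZeta s)
    rw [mul_one] at h
    refine h.congr' ?_
    filter_upwards [self_mem_nhdsWithin] with w hw
    have : w - s ≠ 0 := sub_ne_zero.2 hw
    rw [slope_def_field, hc]
    field_simp
    ring

/-- For functions `G N` on the half-planes `i + 1 - N < Re s` that agree where they overlap, the
common extension to the plane. -/
noncomputable def glueHalfPlanes (i : ℕ) (G : ℕ → ℂ → ℂ) (s : ℂ) : ℂ :=
  G ⌈(i : ℝ) + 2 - s.re⌉₊ s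

lemma glueHalfPlanes_eq {i : ℕ} {G : ℕ → ℂ → ℂ}
    (hG : ∀ (N : ℕ) (s : ℂ), (i : ℝ) + 1 - N < s.re → G N s = G (N + 1) s) {N : ℕ} {s : ℂ}
    (hs : (i : ℝ) + 1 - N < s.re) : glueHalfPlanes i G s = G N s := by
  have key : ∀ N M : ℕ, N ≤ M → (i : ℝ) + 1 - N < s.re → G N s = G M s := by
    intro N M hNM hN
    induction M, hNM using Nat.le_induction with
    | base => rfl
    | succ M hM ih =>
      rw [ih, hG M s]
      have : (N : ℝ) ≤ M := by exact_mod_cast hM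
      linarith
  have h0 : (i : ℝ) + 1 - (⌈(i : ℝ) + 2 - s.re⌉₊ : ℕ) < s.re := by
    have := Nat.le_ceil ((i : ℝ) + 2 - s.re)
    linarith
  rcases le_total N ⌈(i : ℝ) + 2 - s.re⌉₊ with h | h
  · exact (key _ _ h hs).symm
  · exact key _ _ h h0

lemma eventuallyEq_glueHalfPlanes {i : ℕ} {G : ℕ → ℂ → ℂ}
    (hG : ∀ (N : ℕ) (s : ℂ), (i : ℝ) + 1 - N < s.re → G N s = G (N + 1) s) {N : ℕ} {s : ℂ}
    (hs : (i : ℝ) + 1 - N < s.re) : glueHalfPlanes i G =ᶠ[𝓝 s] G N := by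
  filter_upwards [(isOpen_lt continuous_const Complex.continuous_re).mem_nhds hs] with w hw
    using glueHalfPlanes_eq hG hw

lemma differentiableAt_glueHalfPlanes {i : ℕ} {G : ℕ → ℂ → ℂ}
    (hG : ∀ (N : ℕ) (s : ℂ), (i : ℝ) + 1 - N < s.re → G N s = G (N + 1) s) {s : ℂ}
    (hd : ∀ N : ℕ, (i : ℝ) + 1 - N < s.re → DifferentiableAt ℂ (G N) s) :
    DifferentiableAt ℂ (glueHalfPlanes i G) s := by
  obtain ⟨N, hN⟩ := exists_nat_gt ((i : ℝ) + 1 - s.re)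
  have hN' : (i : ℝ) + 1 - N < s.re := by linarith
  exact (hd N hN').congr_of_eventuallyEq (eventuallyEq_glueHalfPlanes hG hN')

/-- The continuation of the moment `∑ k ^ i (k + a) ^ (-s)` to the half-plane `i + 1 - N < Re s`. In
`zetaReg (binomNeg j) (i + 1 - j) s` the zeta factor is `ζ (s + j - i)`. -/
noncomputable def hurwitzMomentPart (i : ℕ) (a : ℂ) (N : ℕ) (s : ℂ) : ℂ :=
  ∑ j ∈ Finset.range N, a ^ j * zetaReg (binomNeg j) (i + 1 - j) s + momentRemainder i a N s

/-- The continuation in `s` of the moment series `∑ k ^ i (k + a) ^ (-s)` over `k ≥ 1`. -/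
noncomputable def hurwitzMoment (i : ℕ) (a : ℂ) : ℂ → ℂ :=
  glueHalfPlanes i (hurwitzMomentPart i a)

lemma ne_of_re_gt {i N : ℕ} {s : ℂ} (hs : (i : ℝ) + 1 - N < s.re) : s ≠ i + 1 - N := by
  rintro rfl
  simp at hs

lemma hurwitzMomentPart_succ (i : ℕ) (a : ℂ) (N : ℕ) (s : ℂ) (hs : (i : ℝ) + 1 - N < s.re) :
    hurwitzMomentPart i a N s = hurwitzMomentPart i a (N + 1) s := by
  rw [hurwitzMomentPart, hurwitzMomentPart, Finset.sum_range_succ,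
    momentRemainder_eq_add_succ i a N hs, zetaReg_of_ne _ (ne_of_re_gt hs),
    show s - ((i : ℂ) + 1 - N) + 1 = s + N - i by ring]
  ring

lemma hurwitzMoment_eq_part (i : ℕ) (a : ℂ) {N : ℕ} {s : ℂ} (hs : (i : ℝ) + 1 - N < s.re) :
    hurwitzMoment i a s = hurwitzMomentPart i a N s :=
  glueHalfPlanes_eq (hurwitzMomentPart_succ i a) hs

lemma hasSum_hurwitzMoment (i : ℕ) (a : ℂ) {s : ℂ} (hs : (i : ℝ) + 1 < s.re) :
    HasSum (fun k : ℕ => (k + 1 : ℂ) ^ i * negCpow (k + 1 + a) s) (hurwitzMoment i a s) := by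
  have hs' : (i : ℝ) + 1 - (0 : ℕ) < s.re := by simpa using hs
  have h := hasSum_momentRemainder i a 0 hs'
  rw [hurwitzMoment_eq_part i a hs', hurwitzMomentPart]
  have h0 : momentTerm i a 0 s = fun k : ℕ => (k + 1 : ℂ) ^ i * negCpow (k + 1 + a) s := by
    funext k
    simp [momentTerm]
  simpa [h0] using h

/-- The poles of the moment are among `1, …, i + 1`: the binomial coefficient cancels the others. -/
lemma differentiableAt_hurwitzMoment (i : ℕ) (a : ℂ) {s : ℂ}
    (hs : ∀ l ∈ Finset.Icc 1 (i + 1), s ≠ (l : ℂ)) : DifferentiableAt ℂ (hurwitzMoment i a) s := by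
  refine differentiableAt_glueHalfPlanes (hurwitzMomentPart_succ i a) fun N hN => ?_
  refine DifferentiableAt.add (DifferentiableAt.fun_sum fun j _ => ?_)
    (differentiableAt_momentRemainder i a N hN)
  refine DifferentiableAt.const_mul ?_ _
  rcases le_or_gt j i with hj | hj
  · refine differentiableAt_zetaReg_of_ne (differentiable_binomNeg j) ?_
    convert! hs (i + 1 - j) (by simp; omega) using 1
    push_cast [show j ≤ i + 1 by omega]
    ring
  · refine differentiable_zetaReg (differentiable_binomNeg j) ?_ s
    obtain ⟨m, rfl⟩ : ∃ m, j = i + 1 + m := ⟨j - (i + 1), by omega⟩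
    rw [show (i : ℂ) + 1 - (i + 1 + m : ℕ) = -m by push_cast; ring]
    exact binomNeg_eq_zero (by omega)

/-- The entire function `ζ (1 + t) (1 - exp (-π i t))`. -/
noncomputable def twistedZeta : ℂ → ℂ :=
  zetaReg (fun t => 1 - Complex.exp (-(Real.pi * Complex.I * t))) 0

lemma differentiable_twistedZeta : Differentiable ℂ twistedZeta :=
  differentiable_zetaReg (by fun_prop) (by simp)

lemma twistedZeta_of_ne_zero {t : ℂ} (ht : t ≠ 0) :
    twistedZeta t = (1 - Complex.exp (-(Real.pi * Complex.I * t))) * riemannZeta (1 + t) := by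
  rw [twistedZeta, zetaReg_of_ne _ ht, sub_zero, add_comm t]

lemma twistedZeta_zero : twistedZeta 0 = Real.pi * Complex.I := by
  rw [twistedZeta, zetaReg_self]
  have h := (((hasDerivAt_id (0 : ℂ)).const_mul (Real.pi * Complex.I)).neg.cexp).const_sub 1
  simpa using! h.deriv

/-- The combination of the moments at `a` and `-a` on the half-plane `i + 1 - N < Re s`. The two
zeta terms with index `j` combine to a value of the entire function `twistedZeta`. -/
noncomputable def bilateralMomentPart (i : ℕ) (a : ℂ) (N : ℕ) (s : ℂ) : ℂ :=
  ∑ j ∈ Finset.range N, a ^ j * (binomNeg j s * twistedZeta (s + j - i - 1))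
    + (momentRemainder i a N s
      + (-1) ^ i * Complex.exp (-(Real.pi * Complex.I * s)) * momentRemainder i (-a) N s)

/-- The entire continuation of
`∑ k ^ i (k + a) ^ (-s) + (-1) ^ i exp (-π i s) ∑ k ^ i (k - a) ^ (-s)`, the sums over `k ≥ 1`. -/
noncomputable def bilateralMoment (i : ℕ) (a : ℂ) : ℂ → ℂ :=
  glueHalfPlanes i (bilateralMomentPart i a)

lemma exp_neg_pi_mul_I_mul_natCast (n : ℕ) :
    Complex.exp (-(Real.pi * Complex.I * n)) = (-1) ^ n := by
  rw [show -((Real.pi : ℂ) * Complex.I * n) = n * -(Real.pi * Complex.I) by ring,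
    Complex.exp_nat_mul, Complex.exp_neg, Complex.exp_pi_mul_I]
  norm_num

lemma bilateralMomentPart_succ (i : ℕ) (a : ℂ) (N : ℕ) (s : ℂ) (hs : (i : ℝ) + 1 - N < s.re) :
    bilateralMomentPart i a N s = bilateralMomentPart i a (N + 1) s := by
  have hne : s + N - i - 1 ≠ 0 := fun h => ne_of_re_gt hs (by linear_combination h)
  have hexp : Complex.exp (-(Real.pi * Complex.I * (s + N - i - 1)))
      = -((-1) ^ (i + N) * Complex.exp (-(Real.pi * Complex.I * s))) := by
    have h1 : Complex.exp (-(Real.pi * Complex.I * (s + N - i - 1)))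
        = Complex.exp (-(Real.pi * Complex.I * s)) * Complex.exp (-(Real.pi * Complex.I * N))
          * (Complex.exp (-(Real.pi * Complex.I * (i + 1 : ℕ))))⁻¹ := by
      rw [← Complex.exp_neg (-(Real.pi * Complex.I * (i + 1 : ℕ))), ← Complex.exp_add,
        ← Complex.exp_add]
      congr 1
      push_cast
      ring
    rw [h1, exp_neg_pi_mul_I_mul_natCast, exp_neg_pi_mul_I_mul_natCast, ← inv_pow]
    norm_num
    ring
  rw [bilateralMomentPart, bilateralMomentPart, Finset.sum_range_succ,
    momentRemainder_eq_add_succ i a N hs, momentRemainder_eq_add_succ i (-a) N hs,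
    twistedZeta_of_ne_zero hne, hexp, neg_pow a N,
    show 1 + (s + N - (i : ℂ) - 1) = s + N - i by ring]
  ring

lemma bilateralMoment_eq_part (i : ℕ) (a : ℂ) {N : ℕ} {s : ℂ} (hs : (i : ℝ) + 1 - N < s.re) :
    bilateralMoment i a s = bilateralMomentPart i a N s :=
  glueHalfPlanes_eq (bilateralMomentPart_succ i a) hs

lemma bilateralMoment_eq_hurwitzMoment (i : ℕ) (a : ℂ) {s : ℂ} (hs : (i : ℝ) + 1 < s.re) :
    bilateralMoment i a s = hurwitzMoment i a s
      + (-1) ^ i * Complex.exp (-(Real.pi * Complex.I * s)) * hurwitzMoment i (-a) s := by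
  have hs' : (i : ℝ) + 1 - (0 : ℕ) < s.re := by simpa using hs
  rw [bilateralMoment_eq_part i a hs', hurwitzMoment_eq_part i a hs',
    hurwitzMoment_eq_part i (-a) hs']
  simp [bilateralMomentPart, hurwitzMomentPart]

lemma differentiable_bilateralMoment (i : ℕ) (a : ℂ) : Differentiable ℂ (bilateralMoment i a) := by
  intro s
  refine differentiableAt_glueHalfPlanes (bilateralMomentPart_succ i a) fun N hN => ?_
  refine DifferentiableAt.add (DifferentiableAt.fun_sum fun j _ => ?_)
    ((differentiableAt_momentRemainder i a N hN).add (DifferentiableAt.mul (by fun_prop)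
      (differentiableAt_momentRemainder i (-a) N hN)))
  refine ((differentiable_binomNeg j).differentiableAt.mul ?_).const_mul _
  exact (differentiable_twistedZeta.comp
    (((differentiable_id.add_const (j : ℂ)).sub_const (i : ℂ)).sub_const 1)).differentiableAt

/-! ### Weights of the multiple Hurwitz zeta function -/

/-- For `r ≥ 1`, the polynomial `(X + 1)_{r - 1} / (r - 1)!`, whose value at `k` is the number of
`m : Fin r → ℕ` with sum `k`. -/
noncomputable def zetaWeight (r : ℕ) : Polynomial ℂ :=
  Polynomial.C (1 / ((r - 1).factorial : ℂ)) * (ascPochhammer ℂ (r - 1)).comp (Polynomial.X + 1)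

lemma eval_zetaWeight (r : ℕ) (x : ℂ) : (zetaWeight r).eval x
    = 1 / ((r - 1).factorial : ℂ) * (ascPochhammer ℂ (r - 1)).eval (x + 1) := by
  simp [zetaWeight, Polynomial.eval_comp]

lemma eval_zetaWeight_eq_sum {r : ℕ} (hr : 1 ≤ r) (x : ℂ) :
    (zetaWeight r).eval x = ∑ i ∈ Finset.range r, (zetaWeight r).coeff i * x ^ i := by
  refine Polynomial.eval_eq_sum_range' ?_ x
  refine (Polynomial.natDegree_C_mul_le _ _).trans_lt ?_
  rw [Polynomial.natDegree_comp, ascPochhammer_natDegree,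
    show (Polynomial.X + 1 : Polynomial ℂ) = Polynomial.X + Polynomial.C 1 by simp,
    Polynomial.natDegree_X_add_C]
  omega

lemma eval_zetaWeight_natCast {r : ℕ} (hr : 1 ≤ r) (k : ℕ) :
    (zetaWeight r).eval (k : ℂ) = Nat.multichoose r k := by
  obtain ⟨d, rfl⟩ : ∃ d, r = d + 1 := ⟨r - 1, by omega⟩
  have h0 : (d.factorial : ℂ) ≠ 0 := by exact_mod_cast d.factorial_ne_zero
  rw [eval_zetaWeight, Nat.multichoose_eq, Nat.add_sub_cancel, show d + 1 + k - 1 = k + d by omega,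
    show (k : ℂ) + 1 = ((k + 1 : ℕ) : ℂ) by push_cast; ring,
    ascPochhammer_nat_eq_natCast_ascFactorial, Nat.ascFactorial_eq_factorial_mul_choose,
    Nat.choose_symm_add]
  push_cast
  field_simp

lemma eval_zetaWeight_reflect {r : ℕ} (hr : 1 ≤ r) (x : ℂ) :
    (zetaWeight r).eval (-(r + x)) = (-1) ^ (r - 1) * (zetaWeight r).eval x := by
  obtain ⟨d, rfl⟩ : ∃ d, r = d + 1 := ⟨r - 1, by omega⟩
  rw [eval_zetaWeight, eval_zetaWeight, Nat.add_sub_cancel,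
    show -(((d + 1 : ℕ) : ℂ) + x) + 1 = -(d + x) by push_cast; ring,
    ascPochhammer_eval_neg_eq_descPochhammer, descPochhammer_eval_eq_ascPochhammer,
    show (d : ℂ) + x - d + 1 = x + 1 by ring]
  ring

lemma eval_zetaWeight_neg_eq_zero {r k : ℕ} (h : k + 1 < r) :
    (zetaWeight r).eval (-(k + 1 : ℂ)) = 0 := by
  rw [eval_zetaWeight, show -(k + 1 : ℂ) + 1 = -k by ring, mul_eq_zero]
  right
  exact (ascPochhammer_eval_eq_zero_iff _ _).2 ⟨k, by omega, by simp⟩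

/-! ### Continuation of the multiple Hurwitz and bilateral series -/

/-- The explicit continuation of `ζ_r(s, a)`. The first summand is the term with `k = 0`, which is
absent for `a = 0`. -/
noncomputable def zetaCont (r : ℕ) (a s : ℂ) : ℂ :=
  negCpow a s + ∑ i ∈ Finset.range r, (zetaWeight r).coeff i * hurwitzMoment i a s

/-- The explicit entire continuation of `K_r(s, a)`. -/
noncomputable def bilateralKCont (r : ℕ) (a s : ℂ) : ℂ :=
  negCpow a s + ∑ i ∈ Finset.range r, (zetaWeight r).coeff i * bilateralMoment i a s

lemma add_one_lt_re_of_mem {r i : ℕ} {s : ℂ} (hs : (r : ℝ) < s.re) (hi : i ∈ Finset.range r) :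
    (i : ℝ) + 1 < s.re := by
  have : ((i + 1 : ℕ) : ℝ) ≤ r := by exact_mod_cast Finset.mem_range.1 hi
  push_cast at this
  linarith

lemma ne_zero_of_natCast_lt_re {r : ℕ} {s : ℂ} (hs : (r : ℝ) < s.re) : s ≠ 0 := by
  rintro rfl
  have : (0 : ℝ) ≤ r := r.cast_nonneg
  simp at hs
  linarith

lemma hasSum_eval_zetaWeight_mul_negCpow {r : ℕ} (hr : 1 ≤ r) (a : ℂ) {s : ℂ}
    (hs : (r : ℝ) < s.re) :
    HasSum (fun k : ℕ => (zetaWeight r).eval (k + 1 : ℂ) * negCpow (k + 1 + a) s)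
      (∑ i ∈ Finset.range r, (zetaWeight r).coeff i * hurwitzMoment i a s) := by
  have h := hasSum_sum (s := Finset.range r) fun i hi =>
    (hasSum_hurwitzMoment i a (add_one_lt_re_of_mem hs hi)).mul_left ((zetaWeight r).coeff i)
  refine h.congr_fun fun k => ?_
  rw [eval_zetaWeight_eq_sum hr, Finset.sum_mul]
  exact Finset.sum_congr rfl fun i _ => by ring

lemma hasSum_zetaCont (r : ℕ) (a : ℂ) {s : ℂ} (hs : (r : ℝ) < s.re) :
    HasSum (fun k : ℕ => (Nat.multichoose r k : ℂ) * negCpow (k + a) s) (zetaCont r a s) := by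
  have h : HasSum (fun k : ℕ => (Nat.multichoose r (k + 1) : ℂ) * negCpow ((k + 1 : ℕ) + a) s)
      (∑ i ∈ Finset.range r, (zetaWeight r).coeff i * hurwitzMoment i a s) := by
    rcases Nat.eq_zero_or_pos r with rfl | hr
    · simp
    · refine (hasSum_eval_zetaWeight_mul_negCpow hr a hs).congr_fun fun k => ?_
      rw [← eval_zetaWeight_natCast hr]
      push_cast
      rfl
  have h1 := (hasSum_nat_add_iff (f := fun k : ℕ => (Nat.multichoose r k : ℂ) * negCpow (k + a) s)
    1).1 h
  rw [add_comm] at h1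
  simpa only [zetaCont, Finset.range_one, Finset.sum_singleton, Nat.multichoose_zero_right,
    Nat.cast_one, one_mul, Nat.cast_zero, zero_add] using h1

/-- Grouping the index `m` by the sum of its entries, with `multichoose r k` indices of sum `k`. -/
lemma hasSum_multipleHurwitzTerm (r : ℕ) (a : ℂ) {s : ℂ} (hs : (r : ℝ) < s.re) :
    HasSum (multipleHurwitzTerm r a s) (zetaCont r a s) := by
  have hterm : multipleHurwitzTerm r a s
      = fun m => negCpow ((∑ i, m i : ℕ) + a) s := by
    funext m
    rw [multipleHurwitzTerm, one_div_cpow_eq_negCpow _ (ne_zero_of_natCast_lt_re hs)]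
    push_cast
    rfl
  have hcard : ∀ k : ℕ,
      Nat.card {m : Fin r → ℕ // ∑ i, m i = k} = Nat.multichoose r k := fun k => by
    rw [← Nat.card_congr (Sym.equivNatSumOfFintype (Fin r) k), Nat.card_eq_fintype_card,
      Sym.card_sym_eq_multichoose, Fintype.card_fin]
  have hfin : ∀ k : ℕ, Finite {m : Fin r → ℕ // ∑ i, m i = k} := fun k =>
    Finite.of_equiv _ (Sym.equivNatSumOfFintype (Fin r) k)
  let e := Equiv.sigmaFiberEquiv fun m : Fin r → ℕ => ∑ i, m i
  have hconst : ∀ (k : ℕ) (m : {m : Fin r → ℕ // ∑ i, m i = k}),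
      (multipleHurwitzTerm r a s ∘ e) ⟨k, m⟩ = negCpow (k + a) s := fun k m => by
    simp only [Function.comp, hterm, e, Equiv.sigmaFiberEquiv, Equiv.coe_fn_mk, m.2]
  have hsum : Summable (multipleHurwitzTerm r a s ∘ e) := by
    refine Summable.of_norm ((summable_sigma_of_nonneg fun _ => norm_nonneg _).2
      ⟨fun k => ?_, ?_⟩)
    · have := hfin k
      exact Summable.of_finite
    · refine (hasSum_zetaCont r a hs).summable.norm.congr fun k => ?_
      simp only [hconst, tsum_const, hcard, norm_mul, Complex.norm_natCast, nsmul_eq_mul]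
  refine e.hasSum_iff.1 (HasSum.sigma_of_hasSum (hasSum_zetaCont r a hs) (fun k => ?_) hsum)
  have := hfin k
  simp only [hconst]
  have h0 : Summable fun _ : {m : Fin r → ℕ // ∑ i, m i = k} => negCpow (k + a) s :=
    Summable.of_finite
  have h := h0.hasSum
  simpa only [tsum_const, hcard, nsmul_eq_mul] using h

/-- On the open lower half-plane and the positive axis, negation increases the principal argument
by `π`. -/
lemma negCpow_neg {w : ℂ} (hw : w.im < 0 ∨ w.im = 0 ∧ 0 < w.re) (s : ℂ) :
    negCpow (-w) s = Complex.exp (-(Real.pi * Complex.I * s)) * negCpow w s := by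
  have hw0 : w ≠ 0 := by
    rintro rfl
    simp at hw
  have hlog : Complex.log (-w) = Complex.log w + Real.pi * Complex.I := by
    rw [Complex.log, Complex.log, norm_neg, Complex.arg_neg_eq_arg_add_pi_iff.2 hw]
    push_cast
    ring
  rw [negCpow_of_ne_zero hw0, negCpow_of_ne_zero (neg_ne_zero.2 hw0),
    Complex.cpow_def_of_ne_zero hw0, Complex.cpow_def_of_ne_zero (neg_ne_zero.2 hw0), hlog,
    ← Complex.exp_add]
  congr 1
  ring

lemma bilateralKTerm_eq (r : ℕ) (z : ℂ) {s : ℂ} (hs : s ≠ 0) (m : ℤ) :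
    bilateralKTerm r z s m = (zetaWeight r).eval (m : ℂ) * negCpow (m + z) s := by
  rw [bilateralKTerm, eval_zetaWeight, ← one_div_cpow_eq_negCpow _ hs]
  ring

/-- For these `z` and all `k ≥ 0`, the number `k + (r - z)` satisfies the condition of
`negCpow_neg`: its negative `-(r + k) + z` has the principal argument larger by `π`. -/
lemma reflect_arg_condition {r : ℕ} {z : ℂ} (hz : 0 < z.im ∨ (z.im = 0 ∧ z.re < r)) (k : ℕ) :
    (k + (r - z)).im < 0 ∨ (k + (r - z)).im = 0 ∧ 0 < (k + (r - z)).re := by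
  have hk : (0 : ℝ) ≤ k := k.cast_nonneg
  simp
  rcases hz with h | ⟨h1, h2⟩
  · exact Or.inl h
  · exact Or.inr ⟨h1, by linarith⟩

/-- The part of `K_r(s, z)` over the negative integers is a multiple of `ζ_r(s, r - z)`: the
weights at `-1, …, -(r - 1)` vanish. -/
lemma hasSum_negative_bilateralKTerm {r : ℕ} (hr : 1 ≤ r) {z : ℂ}
    (hz : 0 < z.im ∨ (z.im = 0 ∧ z.re < r)) {s : ℂ} (hs : (r : ℝ) < s.re) :
    HasSum (fun k : ℕ => bilateralKTerm r z s (-(k + 1)))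
      ((-1) ^ (r - 1) * Complex.exp (-(Real.pi * Complex.I * s)) * zetaCont r (r - z) s) := by
  have h0 : ∑ k ∈ Finset.range (r - 1), bilateralKTerm r z s (-(k + 1)) = 0 := by
    refine Finset.sum_eq_zero fun k hk => ?_
    rw [bilateralKTerm_eq r z (ne_zero_of_natCast_lt_re hs)]
    push_cast
    rw [eval_zetaWeight_neg_eq_zero (by have := Finset.mem_range.1 hk; omega), zero_mul]
  refine (hasSum_nat_add_iff' (r - 1)).1 ?_
  rw [h0, sub_zero]
  refine ((hasSum_zetaCont r (r - z) hs).mul_left _).congr_fun fun k => ?_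
  have hcast : ((r - 1 : ℕ) : ℂ) + 1 = r := by
    rw [← Nat.cast_add_one, Nat.sub_add_cancel hr]
  rw [bilateralKTerm_eq r z (ne_zero_of_natCast_lt_re hs)]
  push_cast
  rw [show -((k : ℂ) + ((r - 1 : ℕ) : ℂ) + 1) = -(r + k) by linear_combination -hcast,
    eval_zetaWeight_reflect hr, eval_zetaWeight_natCast hr,
    show -((r : ℂ) + k) + z = -(k + (r - z)) by ring, negCpow_neg (reflect_arg_condition hz k)]
  ring

lemma hasSum_nonnegative_bilateralKTerm {r : ℕ} (hr : 1 ≤ r) (z : ℂ) {s : ℂ}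
    (hs : (r : ℝ) < s.re) :
    HasSum (fun k : ℕ => bilateralKTerm r z s k) (zetaCont r z s) := by
  refine (hasSum_zetaCont r z hs).congr_fun fun k => ?_
  rw [bilateralKTerm_eq r z (ne_zero_of_natCast_lt_re hs), ← eval_zetaWeight_natCast hr]
  push_cast
  rfl

lemma hasSum_bilateralKTerm {r : ℕ} (hr : 1 ≤ r) {z : ℂ}
    (hz : 0 < z.im ∨ (z.im = 0 ∧ z.re < r)) {s : ℂ} (hs : (r : ℝ) < s.re) :
    HasSum (bilateralKTerm r z s) (zetaCont r z s
      + (-1) ^ (r - 1) * Complex.exp (-(Real.pi * Complex.I * s)) * zetaCont r (r - z) s) :=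
  (hasSum_nonnegative_bilateralKTerm hr z hs).of_nat_of_neg_add_one
    (hasSum_negative_bilateralKTerm hr hz hs)

/-- The moments in `bilateralKCont` take the powers of `k - z` also for `1 ≤ k < r`, where `k - z`
may violate the condition of `negCpow_neg`; these terms have total weight `0`. -/
lemma bilateralKCont_eq {r : ℕ} (hr : 1 ≤ r) {z : ℂ}
    (hz : 0 < z.im ∨ (z.im = 0 ∧ z.re < r)) {s : ℂ} (hs : (r : ℝ) < s.re) :
    bilateralKCont r z s = zetaCont r z s
      + (-1) ^ (r - 1) * Complex.exp (-(Real.pi * Complex.I * s)) * zetaCont r (r - z) s := by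
  have h1 : HasSum (fun k : ℕ => bilateralKTerm r z s (-(k + 1)))
      (∑ i ∈ Finset.range r, (zetaWeight r).coeff i * ((-1) ^ i
        * Complex.exp (-(Real.pi * Complex.I * s)) * hurwitzMoment i (-z) s)) := by
    have h := hasSum_sum (s := Finset.range r) fun i hi =>
      ((hasSum_hurwitzMoment i (-z) (add_one_lt_re_of_mem hs hi)).mul_left
        ((-1) ^ i * Complex.exp (-(Real.pi * Complex.I * s)))).mul_left ((zetaWeight r).coeff i)
    refine h.congr_fun fun k => ?_
    rw [bilateralKTerm_eq r z (ne_zero_of_natCast_lt_re hs)]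
    push_cast
    have h2 : ∑ i ∈ Finset.range r, (zetaWeight r).coeff i * ((-1) ^ i
        * Complex.exp (-(Real.pi * Complex.I * s)) * ((k + 1 : ℂ) ^ i * negCpow (k + 1 + -z) s))
        = (zetaWeight r).eval (-(k + 1 : ℂ))
          * (Complex.exp (-(Real.pi * Complex.I * s)) * negCpow (k + 1 + -z) s) := by
      rw [eval_zetaWeight_eq_sum hr, Finset.sum_mul]
      refine Finset.sum_congr rfl fun i _ => ?_
      rw [neg_pow (k + 1 : ℂ)]
      ring
    rw [h2]
    rcases lt_or_ge (k + 1) r with hk | hk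
    · rw [eval_zetaWeight_neg_eq_zero hk, zero_mul, zero_mul]
    · obtain ⟨l, hl⟩ : ∃ l, k + 1 = l + r := ⟨k + 1 - r, by omega⟩
      have hl' : (k + 1 : ℂ) = l + r := by exact_mod_cast hl
      rw [hl', show -((l : ℂ) + r) + z = -(l + (r - z)) by ring,
        negCpow_neg (reflect_arg_condition hz l), show (l : ℂ) + r + -z = l + (r - z) by ring]
  rw [(hasSum_negative_bilateralKTerm hr hz hs).unique h1, zetaCont, bilateralKCont, add_assoc,
    ← Finset.sum_add_distrib]
  congr 1
  refine Finset.sum_congr rfl fun i hi => ?_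
  rw [bilateralMoment_eq_hurwitzMoment i z (add_one_lt_re_of_mem hs hi)]
  ring

lemma hasSum_bilateralHTerm {r : ℕ} (hr : 2 ≤ r) {z : ℂ}
    (hz : 0 < z.im ∨ (z.im = 0 ∧ z.re < 1)) {s : ℂ} (hs : (r : ℝ) < s.re) :
    HasSum (bilateralHTerm r z s) (bilateralMoment (r - 1) z s) := by
  have hs0 := ne_zero_of_natCast_lt_re hs
  have hs' : ((r - 1 : ℕ) : ℝ) + 1 < s.re := by
    rwa [← Nat.cast_add_one, Nat.sub_add_cancel (by omega)]
  have hterm : ∀ m, bilateralHTerm r z s m = (m : ℂ) ^ (r - 1) * negCpow (m + z) s := fun m => by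
    rw [bilateralHTerm, ← one_div_cpow_eq_negCpow _ hs0]
    ring
  have h1 : HasSum (fun k : ℕ => bilateralHTerm r z s k) (hurwitzMoment (r - 1) z s) := by
    refine (hasSum_nat_add_iff' 1).1 ?_
    have h0 : bilateralHTerm r z s 0 = 0 := by
      simp [hterm, show r - 1 ≠ 0 by omega]
    simp only [Finset.range_one, Finset.sum_singleton, Nat.cast_zero, h0, sub_zero]
    refine (hasSum_hurwitzMoment (r - 1) z hs').congr_fun fun k => ?_
    rw [hterm]
    push_cast
    rfl
  have h2 : HasSum (fun k : ℕ => bilateralHTerm r z s (-(k + 1))) ((-1) ^ (r - 1)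
      * Complex.exp (-(Real.pi * Complex.I * s)) * hurwitzMoment (r - 1) (-z) s) := by
    refine ((hasSum_hurwitzMoment (r - 1) (-z) hs').mul_left _).congr_fun fun k => ?_
    have hk := reflect_arg_condition (r := 1) (by simpa using hz) k
    rw [hterm]
    push_cast at hk ⊢
    rw [show -((k : ℂ) + 1) + z = -(k + (1 - z)) by ring, negCpow_neg hk, neg_pow,
      show (k : ℂ) + 1 + -z = k + (1 - z) by ring]
    ring
  rw [bilateralMoment_eq_hurwitzMoment _ _ hs']
  exact h1.of_nat_of_neg_add_one h2

lemma differentiableAt_zetaCont (r : ℕ) (a : ℂ) {s : ℂ} (hs : s ∈ multipleHurwitzDomain r) :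
    DifferentiableAt ℂ (zetaCont r a) s := by
  refine (differentiable_negCpow a s).add (DifferentiableAt.fun_sum fun i hi => ?_)
  refine (differentiableAt_hurwitzMoment i a fun l hl => hs l ?_).const_mul _
  simp only [Finset.mem_range, Finset.mem_Icc] at *
  omega

lemma differentiable_bilateralKCont (r : ℕ) (a : ℂ) : Differentiable ℂ (bilateralKCont r a) :=
  (differentiable_negCpow a).add
    (Differentiable.fun_sum fun i _ => (differentiable_bilateralMoment i a).const_mul _)

lemma isHolomorphicContinuation_zetaCont (r : ℕ) (a : ℂ) :
    IsHolomorphicContinuation (multipleHurwitzSeries r a) r (multipleHurwitzDomain r)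
      (zetaCont r a) :=
  ⟨fun _ hs => (differentiableAt_zetaCont r a hs).differentiableWithinAt,
    fun _ hs => (hasSum_multipleHurwitzTerm r a hs).tsum_eq.symm⟩

lemma isHolomorphicContinuation_bilateralKCont {r : ℕ} (hr : 1 ≤ r) {z : ℂ}
    (hz : 0 < z.im ∨ (z.im = 0 ∧ z.re < r)) :
    IsHolomorphicContinuation (bilateralKSeries r z) r Set.univ (bilateralKCont r z) :=
  ⟨(differentiable_bilateralKCont r z).differentiableOn, fun s hs => by
    rw [bilateralKCont_eq hr hz hs]
    exact (hasSum_bilateralKTerm hr hz hs).tsum_eq.symm⟩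

lemma isHolomorphicContinuation_bilateralMoment {r : ℕ} (hr : 2 ≤ r) {z : ℂ}
    (hz : 0 < z.im ∨ (z.im = 0 ∧ z.re < 1)) :
    IsHolomorphicContinuation (bilateralHSeries r z) r Set.univ (bilateralMoment (r - 1) z) :=
  ⟨(differentiable_bilateralMoment _ z).differentiableOn,
    fun _ hs => (hasSum_bilateralHTerm hr hz hs).tsum_eq.symm⟩

lemma IsHolomorphicContinuation.holomorphicContinuation {f F : ℂ → ℂ} {σ : ℝ} {U : Set ℂ}
    (h : IsHolomorphicContinuation f σ U F) :
    IsHolomorphicContinuation f σ U (_root_.holomorphicContinuation f σ U) := by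
  have h' : ∃ F, IsHolomorphicContinuation f σ U F := ⟨F, h⟩
  rw [_root_.holomorphicContinuation, dif_pos h']
  exact h'.choose_spec

lemma IsHolomorphicContinuation.eqOn_holomorphicContinuation {f F : ℂ → ℂ} {σ : ℝ} {U : Set ℂ}
    (hU : IsOpen U) (hc : IsPreconnected U) (hσ : {s : ℂ | σ < s.re} ⊆ U)
    (h : IsHolomorphicContinuation f σ U F) :
    Set.EqOn (_root_.holomorphicContinuation f σ U) F U :=
  IsHolomorphicContinuation.eqOn hU hc hσ h.holomorphicContinuation h

lemma multipleHurwitzDomain_eq_compl (r : ℕ) :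
    multipleHurwitzDomain r = ((Finset.Icc 1 r).image (fun j : ℕ => (j : ℂ)) : Set ℂ)ᶜ := by
  ext s
  simp only [multipleHurwitzDomain, Set.mem_ofPred_eq, Set.mem_compl_iff, Finset.coe_image,
    Set.mem_image, Finset.mem_coe, not_exists, not_and]
  exact forall₂_congr fun j _ => ⟨fun h h' => h h'.symm, fun h h' => h h'.symm⟩

lemma isOpen_multipleHurwitzDomain (r : ℕ) : IsOpen (multipleHurwitzDomain r) := by
  rw [multipleHurwitzDomain_eq_compl]
  exact (Finset.finite_toSet _).isClosed.isOpen_compl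

lemma isPreconnected_multipleHurwitzDomain (r : ℕ) : IsPreconnected (multipleHurwitzDomain r) := by
  rw [multipleHurwitzDomain_eq_compl]
  exact ((Finset.finite_toSet _).countable.isConnected_compl_of_one_lt_rank
    (by simp)).isPreconnected

lemma halfPlane_subset_multipleHurwitzDomain (r : ℕ) :
    {s : ℂ | (r : ℝ) < s.re} ⊆ multipleHurwitzDomain r := by
  rintro s hs j hj rfl
  have h : (r : ℝ) < j := by simpa using hs
  have := (Finset.mem_Icc.1 hj).2
  exact absurd (Nat.cast_lt.1 h) (by omega)

lemma one_sub_natCast_mem_multipleHurwitzDomain (r : ℕ) {n : ℕ} (hn : 1 ≤ n) :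
    (1 - n : ℂ) ∈ multipleHurwitzDomain r := by
  intro j hj h
  have h1 : (1 : ℂ) = ((j + n : ℕ) : ℂ) := by push_cast; linear_combination h
  have h2 : 1 = j + n := by exact_mod_cast h1
  have := (Finset.mem_Icc.1 hj).1
  omega

/-- The identity `K_r(s, z) = ζ_r(s, z) + (-1) ^ (r - 1) exp (-π i s) ζ_r(s, r - z)` continues. -/
lemma eqOn_bilateralKCont {r : ℕ} (hr : 1 ≤ r) {z : ℂ}
    (hz : 0 < z.im ∨ (z.im = 0 ∧ z.re < r)) :
    Set.EqOn (bilateralKCont r z) (fun s => zetaCont r z s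
      + (-1) ^ (r - 1) * Complex.exp (-(Real.pi * Complex.I * s)) * zetaCont r (r - z) s)
      (multipleHurwitzDomain r) := by
  refine IsHolomorphicContinuation.eqOn (f := bilateralKCont r z) (σ := r)
    (isOpen_multipleHurwitzDomain r) (isPreconnected_multipleHurwitzDomain r)
    (halfPlane_subset_multipleHurwitzDomain r)
    ⟨(differentiable_bilateralKCont r z).differentiableOn, fun _ _ => rfl⟩
    ⟨fun s hs => DifferentiableAt.differentiableWithinAt ?_,
      fun s hs => (bilateralKCont_eq hr hz hs).symm⟩
  exact (differentiableAt_zetaCont r z hs).add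
    (DifferentiableAt.mul (by fun_prop) (differentiableAt_zetaCont r _ hs))

/-! ### Values at nonpositive integers -/

/-- The value of the continued `ζ_r(s, a)` at `s = 1 - n`, as a polynomial in `a`. -/
noncomputable def zetaValuePoly (r n : ℕ) : Polynomial ℂ :=
  Polynomial.X ^ (n - 1) + ∑ i ∈ Finset.range r, Polynomial.C ((zetaWeight r).coeff i)
    * ∑ j ∈ Finset.range (r + n),
      Polynomial.C (zetaReg (binomNeg j) (i + 1 - j) (1 - n)) * Polynomial.X ^ j

lemma zetaCont_one_sub_natCast (r : ℕ) {n : ℕ} (hn : 1 ≤ n) {a : ℂ}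
    (ha : ∀ k : ℕ, (k : ℂ) + a ≠ 0) : zetaCont r a (1 - n) = (zetaValuePoly r n).eval a := by
  have ha' : ∀ k : ℕ, (k + 1 : ℂ) + a ≠ 0 := fun k => by simpa using ha (k + 1)
  have h0 : a ≠ 0 := by simpa using ha 0
  rw [zetaCont, negCpow_one_sub_natCast hn h0, zetaValuePoly]
  simp only [Polynomial.eval_add, Polynomial.eval_pow, Polynomial.eval_X,
    Polynomial.eval_finsetSum, Polynomial.eval_mul, Polynomial.eval_C]
  congr 1
  refine Finset.sum_congr rfl fun i hi => ?_
  have hir : (i : ℝ) + 1 ≤ r := by exact_mod_cast Finset.mem_range.1 hi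
  have hre : (i : ℝ) + 1 - (r + n : ℕ) < (1 - n : ℂ).re := by
    simp
    linarith
  rw [hurwitzMoment_eq_part i a hre, hurwitzMomentPart,
    momentRemainder_one_sub_natCast i ha' hn (by omega), add_zero]
  exact congrArg _ (Finset.sum_congr rfl fun j _ => mul_comm _ _)

/-- The relation `(j + 1) binom (-s, j + 1) = -s binom (-s - 1, j)` at `s = -n`. The zeta factors on
the two sides coincide, and so do their poles. -/
lemma zetaReg_binomNeg_succ (i j : ℕ) {n : ℕ} (hn : 1 ≤ n) :
    (j + 1 : ℂ) * zetaReg (binomNeg (j + 1)) (i + 1 - (j + 1 : ℕ)) (1 - (n + 1 : ℕ))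
      = n * zetaReg (binomNeg j) (i + 1 - j) (1 - n) := by
  by_cases h : (1 - n : ℂ) = i + 1 - j
  · have h' : (1 - (n + 1 : ℕ) : ℂ) = i + 1 - (j + 1 : ℕ) := by
      push_cast
      linear_combination h
    have hj : j = n + i := by
      have : (j : ℂ) = (n + i : ℕ) := by push_cast; linear_combination h
      exact_mod_cast this
    have hz : binomNeg j (1 - n) = 0 := by
      have := binomNeg_eq_zero (show n - 1 < j by omega)
      rwa [show (-((n - 1 : ℕ) : ℂ)) = 1 - n by push_cast [hn]; ring] at this
    rw [← h, ← h', zetaReg_self, zetaReg_self]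
    have hd : HasDerivAt (fun s => (j + 1 : ℂ) * binomNeg (j + 1) s)
        (n * deriv (binomNeg j) (1 - n)) (1 - (n + 1 : ℕ)) := by
      have h1 : HasDerivAt (fun s => binomNeg j (s + 1)) (deriv (binomNeg j) (1 - n))
          (1 - (n + 1 : ℕ)) := by
        refine HasDerivAt.comp_add_const _ _ ?_
        convert! (differentiable_binomNeg j (1 - n)).hasDerivAt using 1
        push_cast
        ring
      have h2 := (hasDerivAt_neg (1 - (n + 1 : ℕ) : ℂ)).mul h1
      simp only [binomNeg_succ_left]
      convert! h2 using 1
      rw [show (1 - (n + 1 : ℕ) + 1 : ℂ) = 1 - n by push_cast; ring, hz]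
      push_cast
      ring
    rw [← hd.deriv, deriv_const_mul_field]
  · have h' : (1 - (n + 1 : ℕ) : ℂ) ≠ i + 1 - (j + 1 : ℕ) := fun h' => h (by
      push_cast at h'
      linear_combination h')
    rw [zetaReg_of_ne _ h, zetaReg_of_ne _ h', ← mul_assoc, binomNeg_succ_left, ← mul_assoc,
      show (1 - (n + 1 : ℕ) + 1 : ℂ) = 1 - n by push_cast; ring,
      show -(1 - (n + 1 : ℕ) : ℂ) = n by push_cast; ring,
      show (1 - (n + 1 : ℕ) - (i + 1 - (j + 1 : ℕ)) + 1 : ℂ) = 1 - n - (i + 1 - j) + 1 by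
        push_cast; ring]

lemma derivative_sum_range_succ_C_mul_X_pow (c : ℕ → ℂ) (N : ℕ) :
    Polynomial.derivative (∑ j ∈ Finset.range (N + 1), Polynomial.C (c j) * Polynomial.X ^ j)
      = ∑ j ∈ Finset.range N, Polynomial.C ((j + 1) * c (j + 1)) * Polynomial.X ^ j := by
  rw [Polynomial.derivative_sum, Finset.sum_range_succ']
  simp only [pow_zero, mul_one, Polynomial.derivative_C, add_zero]
  refine Finset.sum_congr rfl fun j _ => ?_
  rw [Polynomial.derivative_C_mul_X_pow, Nat.add_sub_cancel]
  push_cast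
  rw [mul_comm (c (j + 1))]

lemma derivative_zetaValuePoly_succ (r : ℕ) {n : ℕ} (hn : 1 ≤ n) :
    Polynomial.derivative (zetaValuePoly r (n + 1)) = Polynomial.C (n : ℂ) * zetaValuePoly r n := by
  rw [zetaValuePoly, zetaValuePoly, Polynomial.derivative_add, mul_add, Nat.add_sub_cancel,
    Polynomial.derivative_X_pow, Polynomial.derivative_sum, Finset.mul_sum]
  congr 1
  refine Finset.sum_congr rfl fun i _ => ?_
  rw [Polynomial.derivative_C_mul, ← add_assoc, derivative_sum_range_succ_C_mul_X_pow,
    mul_left_comm (Polynomial.C (n : ℂ))]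
  congr 1
  rw [Finset.mul_sum]
  refine Finset.sum_congr rfl fun j _ => ?_
  rw [zetaReg_binomNeg_succ i j hn, Polynomial.C_mul, mul_assoc]

lemma zetaCont_sub_zetaCont_add_one (r : ℕ) (a : ℂ) {s : ℂ}
    (hs : s ∈ multipleHurwitzDomain (r + 1)) :
    zetaCont (r + 1) a s - zetaCont (r + 1) (a + 1) s = zetaCont r a s := by
  have hsub : multipleHurwitzDomain (r + 1) ⊆ multipleHurwitzDomain r := fun s hs j hj =>
    hs j (by simp only [Finset.mem_Icc] at *; omega)
  refine IsHolomorphicContinuation.eqOn (f := zetaCont r a) (σ := (r + 1 : ℕ))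
    (F := fun s => zetaCont (r + 1) a s - zetaCont (r + 1) (a + 1) s) (G := zetaCont r a)
    (isOpen_multipleHurwitzDomain _) (isPreconnected_multipleHurwitzDomain _)
    (halfPlane_subset_multipleHurwitzDomain _) ⟨fun w hw => ?_, fun w hw => ?_⟩
    ⟨fun w hw => ?_, fun _ _ => rfl⟩ hs
  · exact ((differentiableAt_zetaCont _ _ hw).sub
      (differentiableAt_zetaCont _ _ hw)).differentiableWithinAt
  · have hw' : (r : ℝ) < w.re := by push_cast at hw; linarith
    have h1 := (hasSum_nat_add_iff' 1).2 (hasSum_zetaCont (r + 1) a hw)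
    have h2 := hasSum_zetaCont (r + 1) (a + 1) hw
    have h3 := (hasSum_nat_add_iff' 1).2 (hasSum_zetaCont r a hw')
    simp only [Finset.range_one, Finset.sum_singleton, Nat.multichoose_zero_right] at h1 h3
    have h4 := (h1.sub h2).unique (h3.congr_fun fun k => by
      rw [Nat.multichoose_succ_succ]
      push_cast
      rw [show (k : ℂ) + (a + 1) = k + 1 + a by ring]
      ring)
    linear_combination h4
  · exact (differentiableAt_zetaCont _ _ (hsub hw)).differentiableWithinAt

lemma eval_zetaValuePoly_sub (r : ℕ) {n : ℕ} (hn : 1 ≤ n) (m : ℕ) :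
    (zetaValuePoly (r + 1) n).eval (m + 1 : ℂ) - (zetaValuePoly (r + 1) n).eval (m + 1 + 1 : ℂ)
      = (zetaValuePoly r n).eval (m + 1 : ℂ) := by
  have h1 : ∀ k : ℕ, (k : ℂ) + (m + 1) ≠ 0 := fun k => by
    exact_mod_cast (show k + (m + 1) ≠ 0 by omega)
  have h2 : ∀ k : ℕ, (k : ℂ) + (m + 1 + 1) ≠ 0 := fun k => by
    exact_mod_cast (show k + (m + 1 + 1) ≠ 0 by omega)
  rw [← zetaCont_one_sub_natCast _ hn h1, ← zetaCont_one_sub_natCast _ hn h2,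
    ← zetaCont_one_sub_natCast _ hn h1]
  exact zetaCont_sub_zetaCont_add_one r _ (one_sub_natCast_mem_multipleHurwitzDomain _ hn)

/-! ### Multiple Bernoulli polynomials -/

lemma exp_sub_one_eq_X_mul : PowerSeries.exp ℂ - 1 = PowerSeries.X * expSubOneDivSeries := by
  ext k
  cases k with
  | zero => simp
  | succ k =>
    rw [PowerSeries.coeff_succ_X_mul]
    simp [expSubOneDivSeries, PowerSeries.coeff_exp, PowerSeries.coeff_one]

lemma expSubOneDivSeries_mul_inv : expSubOneDivSeries * expSubOneDivSeries⁻¹ = 1 :=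
  PowerSeries.mul_inv_cancel _ (by simp [expSubOneDivSeries])

/-- The polynomial `(-1) ^ r (n - 1)! / (r + n - 1)! B_{r, r + n - 1}`. -/
noncomputable def bernoulliValuePoly (r n : ℕ) : Polynomial ℂ :=
  ∑ j ∈ Finset.range (r + n), Polynomial.C ((-1) ^ r * ((n - 1).factorial : ℂ)
    * (PowerSeries.coeff (r + n - 1 - j) (expSubOneDivSeries⁻¹ ^ r) / (j.factorial : ℂ)))
    * Polynomial.X ^ j

lemma eval_bernoulliValuePoly_eq_coeff (r : ℕ) {n : ℕ} (hn : 1 ≤ n) (a : ℂ) :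
    (bernoulliValuePoly r n).eval a = (-1) ^ r * ((n - 1).factorial : ℂ)
      * PowerSeries.coeff (r + n - 1)
        (expSubOneDivSeries⁻¹ ^ r * PowerSeries.rescale a (PowerSeries.exp ℂ)) := by
  rw [mul_comm (expSubOneDivSeries⁻¹ ^ r), PowerSeries.coeff_mul,
    Finset.Nat.sum_antidiagonal_eq_sum_range_succ_mk, Nat.succ_eq_add_one,
    show r + n - 1 + 1 = r + n by omega, Finset.mul_sum, bernoulliValuePoly,
    Polynomial.eval_finsetSum]
  refine Finset.sum_congr rfl fun j _ => ?_
  simp [PowerSeries.coeff_exp]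
  ring

lemma eval_bernoulliValuePoly (r : ℕ) {n : ℕ} (hn : 1 ≤ n) (a : ℂ) :
    (bernoulliValuePoly r n).eval a = (-1) ^ r * (((n - 1).factorial : ℂ)
      / ((r + n - 1).factorial : ℂ)) * multipleBernoulli r (r + n - 1) a := by
  have h : ((r + n - 1).factorial : ℂ) ≠ 0 := by exact_mod_cast Nat.factorial_ne_zero _
  rw [eval_bernoulliValuePoly_eq_coeff r hn, multipleBernoulli]
  field_simp

lemma derivative_bernoulliValuePoly_succ (r : ℕ) {n : ℕ} (hn : 1 ≤ n) :
    Polynomial.derivative (bernoulliValuePoly r (n + 1))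
      = Polynomial.C (n : ℂ) * bernoulliValuePoly r n := by
  obtain ⟨m, rfl⟩ : ∃ m, n = m + 1 := ⟨n - 1, by omega⟩
  rw [bernoulliValuePoly, bernoulliValuePoly, ← add_assoc r (m + 1) 1,
    derivative_sum_range_succ_C_mul_X_pow, Finset.mul_sum]
  refine Finset.sum_congr rfl fun j _ => ?_
  conv_rhs => rw [← mul_assoc, ← Polynomial.C_mul]
  congr 2
  have h1 : (j.factorial : ℂ) ≠ 0 := by exact_mod_cast j.factorial_ne_zero
  have h2 : (j + 1 : ℂ) ≠ 0 := by exact_mod_cast j.succ_ne_zero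
  rw [show r + (m + 1) + 1 - 1 - (j + 1) = r + (m + 1) - 1 - j by omega, Nat.add_sub_cancel,
    Nat.add_sub_cancel, Nat.factorial_succ, Nat.factorial_succ]
  push_cast
  field_simp

lemma eval_bernoulliValuePoly_sub (r : ℕ) {n : ℕ} (hn : 1 ≤ n) (a : ℂ) :
    (bernoulliValuePoly (r + 1) n).eval a - (bernoulliValuePoly (r + 1) n).eval (a + 1)
      = (bernoulliValuePoly r n).eval a := by
  have h : expSubOneDivSeries⁻¹ ^ (r + 1) * PowerSeries.rescale (a + 1) (PowerSeries.exp ℂ)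
      = expSubOneDivSeries⁻¹ ^ (r + 1) * PowerSeries.rescale a (PowerSeries.exp ℂ)
        + PowerSeries.X * (expSubOneDivSeries⁻¹ ^ r
          * PowerSeries.rescale a (PowerSeries.exp ℂ)) := by
    rw [← PowerSeries.exp_mul_exp_eq_exp_add, PowerSeries.rescale_one, RingHom.id_apply]
    linear_combination (expSubOneDivSeries⁻¹ ^ (r + 1) * PowerSeries.rescale a (PowerSeries.exp ℂ))
      * exp_sub_one_eq_X_mul + PowerSeries.X * expSubOneDivSeries⁻¹ ^ r
      * PowerSeries.rescale a (PowerSeries.exp ℂ) * expSubOneDivSeries_mul_inv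
  rw [eval_bernoulliValuePoly_eq_coeff _ hn, eval_bernoulliValuePoly_eq_coeff _ hn,
    eval_bernoulliValuePoly_eq_coeff _ hn, h, map_add,
    show r + 1 + n - 1 = r + n - 1 + 1 by omega, PowerSeries.coeff_succ_X_mul]
  ring

/-- A polynomial with period `1` along the positive integers is constant. -/
lemma Polynomial.eq_C_of_eval_add_one {P : Polynomial ℂ}
    (h : ∀ m : ℕ, P.eval (m + 1 : ℂ) = P.eval (m + 1 + 1 : ℂ)) : P = Polynomial.C (P.eval 1) := by
  refine Polynomial.eq_of_infinite_eval_eq _ _ (Set.Infinite.mono ?_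
    (Set.infinite_range_of_injective (f := fun m : ℕ => (m + 1 : ℂ)) fun m n hmn => by
      simpa using hmn))
  rintro _ ⟨m, rfl⟩
  simp only [Set.mem_ofPred_eq, Polynomial.eval_C]
  induction m with
  | zero => simp
  | succ m ih => rw [← ih, h m]; push_cast; rfl

/-- Both families satisfy the same difference equation in `r`, so their difference is a constant
for each `n`; since both satisfy the same derivative relation in `n`, the constants vanish. -/
theorem zetaValuePoly_eq_bernoulliValuePoly (r : ℕ) :
    ∀ n, 1 ≤ n → zetaValuePoly r n = bernoulliValuePoly r n := by
  induction r with
  | zero =>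
    intro n hn
    refine Polynomial.funext fun a => ?_
    rw [eval_bernoulliValuePoly_eq_coeff 0 hn]
    have : ((n - 1).factorial : ℂ) ≠ 0 := by exact_mod_cast Nat.factorial_ne_zero _
    simp [zetaValuePoly, PowerSeries.coeff_exp]
    field_simp
  | succ r ih =>
    have hconst : ∀ n, 1 ≤ n → ∃ c, zetaValuePoly (r + 1) n - bernoulliValuePoly (r + 1) n
        = Polynomial.C c := fun n hn => ⟨_, Polynomial.eq_C_of_eval_add_one fun m => by
      have h1 := eval_zetaValuePoly_sub r hn m
      have h2 := eval_bernoulliValuePoly_sub r hn (m + 1 : ℂ)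
      rw [ih n hn, ← h2] at h1
      rw [Polynomial.eval_sub, Polynomial.eval_sub]
      linear_combination h1⟩
    intro n hn
    obtain ⟨c, hc⟩ := hconst (n + 1) (by omega)
    have h := congrArg Polynomial.derivative hc
    rw [Polynomial.derivative_sub, derivative_zetaValuePoly_succ _ hn,
      derivative_bernoulliValuePoly_succ _ hn, Polynomial.derivative_C, ← mul_sub, mul_eq_zero,
      Polynomial.C_eq_zero, sub_eq_zero] at h
    exact h.resolve_left (by exact_mod_cast (show n ≠ 0 by omega))

/-- The value of `ζ_r(s, a)` at `s = 1 - n`. -/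
theorem zetaCont_one_sub_natCast_eq_bernoulli (r : ℕ) {n : ℕ} (hn : 1 ≤ n) {a : ℂ}
    (ha : ∀ k : ℕ, (k : ℂ) + a ≠ 0) : zetaCont r a (1 - n) = (-1) ^ r
      * (((n - 1).factorial : ℂ) / ((r + n - 1).factorial : ℂ))
      * multipleBernoulli r (r + n - 1) a := by
  rw [zetaCont_one_sub_natCast r hn ha, zetaValuePoly_eq_bernoulliValuePoly r n hn,
    eval_bernoulliValuePoly r hn]

/-- Reflection of the multiple Bernoulli polynomials, a consequence of the identity
`(e ^ (-t) - 1) / (-t) = e ^ (-t) (e ^ t - 1) / t`. -/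
theorem multipleBernoulli_sub (r k : ℕ) (z : ℂ) :
    multipleBernoulli r k (r - z) = (-1) ^ k * multipleBernoulli r k z := by
  have hneg : PowerSeries.exp ℂ * PowerSeries.rescale (-1) (PowerSeries.exp ℂ) = 1 :=
    PowerSeries.exp_mul_exp_neg_eq_one
  have hφ : PowerSeries.exp ℂ * PowerSeries.rescale (-1) expSubOneDivSeries
      = expSubOneDivSeries := by
    refine mul_left_cancel₀ (PowerSeries.X_ne_zero (R := ℂ)) ?_
    have h := congrArg (PowerSeries.rescale (-1 : ℂ)) exp_sub_one_eq_X_mul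
    rw [map_sub, map_mul, map_one, PowerSeries.rescale_neg_one_X] at h
    linear_combination exp_sub_one_eq_X_mul + PowerSeries.exp ℂ * h - hneg
  have hinv : PowerSeries.rescale (-1) expSubOneDivSeries⁻¹
      = PowerSeries.exp ℂ * expSubOneDivSeries⁻¹ := by
    have h := congrArg (PowerSeries.rescale (-1 : ℂ)) expSubOneDivSeries_mul_inv
    rw [map_mul, map_one] at h
    linear_combination (-PowerSeries.rescale (-1) expSubOneDivSeries⁻¹)
      * expSubOneDivSeries_mul_inv - PowerSeries.rescale (-1) expSubOneDivSeries⁻¹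
        * expSubOneDivSeries⁻¹ * hφ + PowerSeries.exp ℂ * expSubOneDivSeries⁻¹ * h
  have h : expSubOneDivSeries⁻¹ ^ r * PowerSeries.rescale (r - z) (PowerSeries.exp ℂ)
      = PowerSeries.rescale (-1)
        (expSubOneDivSeries⁻¹ ^ r * PowerSeries.rescale z (PowerSeries.exp ℂ)) := by
    rw [map_mul, map_pow, hinv, mul_pow, PowerSeries.exp_pow_eq_rescale_exp,
      PowerSeries.rescale_rescale, sub_eq_add_neg, ← PowerSeries.exp_mul_exp_eq_exp_add]
    ring_nf
  rw [multipleBernoulli, multipleBernoulli, h, PowerSeries.coeff_rescale]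
  ring

/-! ### Special values of the twisted zeta function -/

lemma twistedZeta_neg_one : twistedZeta (-1) = -1 := by
  rw [twistedZeta_of_ne_zero (by norm_num), show -((Real.pi : ℂ) * Complex.I * -1)
    = Real.pi * Complex.I by ring, Complex.exp_pi_mul_I, show (1 : ℂ) + -1 = 0 by ring,
    riemannZeta_zero]
  norm_num

lemma twistedZeta_neg_natCast {m : ℕ} (hm : 2 ≤ m) : twistedZeta (-m) = 0 := by
  have hexp : Complex.exp (-((Real.pi : ℂ) * Complex.I * -m)) = (-1) ^ m := by
    rw [show -((Real.pi : ℂ) * Complex.I * -m) = -(-(Real.pi * Complex.I * m)) by ring,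
      Complex.exp_neg, exp_neg_pi_mul_I_mul_natCast, ← inv_pow]
    norm_num
  rw [twistedZeta_of_ne_zero (neg_ne_zero.2 (Nat.cast_ne_zero.2 (by omega))), hexp]
  rcases Nat.even_or_odd' m with ⟨l, rfl | rfl⟩
  · simp
  · obtain ⟨p, rfl⟩ : ∃ p, l = p + 1 := ⟨l - 1, by omega⟩
    rw [show (1 + -((2 * (p + 1) + 1 : ℕ) : ℂ)) = -2 * (p + 1) by push_cast; ring,
      riemannZeta_neg_two_mul_nat_add_one, mul_zero]

/-- By the functional equation of the Riemann zeta function, `twistedZeta t` is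
`sin (π t)` times a function holomorphic near `t = -r`. -/
lemma hasDerivAt_twistedZeta_neg_natCast {r : ℕ} (hr : 2 ≤ r) :
    HasDerivAt twistedZeta
      (((r - 1).factorial : ℂ) / (2 * Real.pi * Complex.I) ^ (r - 1) * riemannZeta r) (-r) := by
  obtain ⟨d, rfl⟩ : ∃ d, r = d + 1 := ⟨r - 1, by omega⟩
  have hpi : (Real.pi : ℂ) ≠ 0 := by exact_mod_cast Real.pi_ne_zero
  -- `twistedZeta t = S t * sin (π t)` for `Re t < -1`
  let S : ℂ → ℂ := fun t => 2 * Complex.I * Complex.exp (-(Real.pi * Complex.I * t / 2))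
    * (2 * Real.pi : ℂ) ^ t * Complex.Gamma (-t) * riemannZeta (-t)
  have heq : twistedZeta =ᶠ[𝓝 (-((d + 1 : ℕ) : ℂ))] fun t => S t * Complex.sin (Real.pi * t) := by
    have hopen : IsOpen {t : ℂ | t.re < -1} := isOpen_lt Complex.continuous_re continuous_const
    have hmem : (-((d + 1 : ℕ) : ℂ)) ∈ {t : ℂ | t.re < -1} := by
      have : (2 : ℝ) ≤ (d + 1 : ℕ) := by exact_mod_cast hr
      simp only [Set.mem_ofPred_eq, Complex.neg_re, Complex.natCast_re]
      linarith
    filter_upwards [hopen.mem_nhds hmem] with t ht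
    have ht' : t.re < -1 := ht
    have ht0 : t ≠ 0 := by
      rintro rfl
      norm_num at ht'
    have h1 : ∀ n : ℕ, -t ≠ -n := fun n h => by
      have h2 := congrArg Complex.re h
      simp at h2
      have : (0 : ℝ) ≤ n := n.cast_nonneg
      linarith
    have h2 : -t ≠ 1 := fun h => by
      have h2 := congrArg Complex.re h
      simp at h2
      linarith
    have h3 := riemannZeta_one_sub h1 h2
    rw [sub_neg_eq_add, neg_neg] at h3
    have h4 : 1 - Complex.exp (-(Real.pi * Complex.I * t))
        = 2 * Complex.I * Complex.exp (-(Real.pi * Complex.I * t / 2))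
          * Complex.sin (Real.pi * t / 2) := by
      rw [Complex.sin, show -(Real.pi * t / 2) * Complex.I = -(Real.pi * Complex.I * t / 2) by ring,
        show Real.pi * t / 2 * Complex.I = Real.pi * Complex.I * t / 2 by ring,
        show -(Real.pi * Complex.I * t) = -(Real.pi * Complex.I * t / 2)
          + -(Real.pi * Complex.I * t / 2) by ring, Complex.exp_add]
      have h5 : Complex.exp (-(Real.pi * Complex.I * t / 2))
          * Complex.exp (Real.pi * Complex.I * t / 2) = 1 := by
        rw [← Complex.exp_add, neg_add_cancel, Complex.exp_zero]
      linear_combination -h5 + (Complex.exp (-(Real.pi * Complex.I * t / 2))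
        * Complex.exp (-(Real.pi * Complex.I * t / 2))
          - Complex.exp (-(Real.pi * Complex.I * t / 2)) * Complex.exp (Real.pi * Complex.I * t / 2))
          * (-Complex.I_sq)
    have h6 : Complex.sin (Real.pi * t) = 2 * Complex.sin (Real.pi * t / 2)
        * Complex.cos (Real.pi * t / 2) := by
      rw [← Complex.sin_two_mul]
      congr 1
      ring
    rw [twistedZeta_of_ne_zero ht0, h3, h4, h6, mul_neg, neg_div, Complex.cos_neg]
    simp only [S]
    ring
  have hSd : DifferentiableAt ℂ S (-((d + 1 : ℕ) : ℂ)) := by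
    have hΓ : DifferentiableAt ℂ (fun t => Complex.Gamma (-t)) (-((d + 1 : ℕ) : ℂ)) := by
      refine DifferentiableAt.comp (g := Complex.Gamma) _ ?_ differentiableAt_id.neg
      refine Complex.differentiableAt_Gamma _ fun m h => ?_
      rw [neg_neg] at h
      have : ((d + 1 + m : ℕ) : ℂ) = 0 := by push_cast at h ⊢; linear_combination h
      exact absurd (Nat.cast_eq_zero.1 this) (by omega)
    have hζ : DifferentiableAt ℂ (fun t => riemannZeta (-t)) (-((d + 1 : ℕ) : ℂ)) := by
      refine DifferentiableAt.comp (g := riemannZeta) _ ?_ differentiableAt_id.neg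
      refine differentiableAt_riemannZeta ?_
      rw [neg_neg]
      exact_mod_cast (show d + 1 ≠ 1 by omega)
    have hp : DifferentiableAt ℂ (fun t : ℂ => (2 * Real.pi : ℂ) ^ t) (-((d + 1 : ℕ) : ℂ)) :=
      differentiableAt_id.const_cpow (Or.inl (by simp [hpi]))
    exact ((DifferentiableAt.mul (by fun_prop) hp).mul hΓ).mul hζ
  have hsin : HasDerivAt (fun t : ℂ => Complex.sin (Real.pi * t)) (Real.pi * (-1) ^ (d + 1))
      (-((d + 1 : ℕ) : ℂ)) := by
    have h := ((hasDerivAt_id (-((d + 1 : ℕ) : ℂ))).const_mul (Real.pi : ℂ)).csin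
    convert! h using 1
    have hcos : Complex.cos (((d + 1 : ℕ) : ℂ) * Real.pi) = (-1) ^ (d + 1) := by
      have := congrArg (fun x : ℝ => (x : ℂ)) (Real.cos_nat_mul_pi (d + 1))
      push_cast at this ⊢
      exact this
    rw [id, mul_one, mul_neg, Complex.cos_neg, mul_comm (Real.pi : ℂ) ((d + 1 : ℕ) : ℂ), hcos]
    ring
  have hsin0 : Complex.sin (Real.pi * -((d + 1 : ℕ) : ℂ)) = 0 := by
    rw [mul_neg, Complex.sin_neg, mul_comm, Complex.sin_nat_mul_pi, neg_zero]
  refine (HasDerivAt.congr_of_eventuallyEq ?_ heq)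
  convert! hSd.hasDerivAt.mul hsin using 1
  have hexp : Complex.exp (-(Real.pi * Complex.I * -((d + 1 : ℕ) : ℂ) / 2))
      = Complex.I ^ (d + 1) := by
    rw [show Complex.I ^ (d + 1) = Complex.exp (Real.pi / 2 * Complex.I) ^ (d + 1) by
      rw [Complex.exp_pi_div_two_mul_I], ← Complex.exp_nat_mul]
    congr 1
    ring
  have hI : (Complex.I ^ d)⁻¹ = (-1) ^ d * Complex.I ^ d := by
    rw [← inv_pow, Complex.inv_I, neg_pow]
  have hI' : Complex.I * Complex.I ^ (d + 1) * (-1) ^ (d + 1) = (-1) ^ d * Complex.I ^ d := by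
    linear_combination -((-1) ^ d * Complex.I ^ d) * Complex.I_sq
  have hpow : ((2 * Real.pi : ℂ) ^ (d + 1))⁻¹ * (2 * Real.pi) = ((2 * Real.pi : ℂ) ^ d)⁻¹ := by
    rw [pow_succ]
    field_simp
  rw [hsin0, mul_zero, zero_add]
  simp only [S]
  rw [hexp, neg_neg, Complex.cpow_neg, Complex.cpow_natCast, Nat.cast_add_one,
    Complex.Gamma_nat_eq_factorial, Nat.add_sub_cancel, mul_pow _ Complex.I, div_eq_mul_inv,
    mul_inv, hI, ← hI', ← hpow]
  ring

/-! ### The primitive multiple sine function -/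

/-- The derivative at `s = 0` of the continued series `H_r(s, z)`: among the zeta terms only those
with `j = 0`, `j = r - 1` and `j = r` survive, because of the trivial zeros. -/
lemma deriv_bilateralMoment_zero {r : ℕ} (hr : 2 ≤ r) {z : ℂ}
    (hz : ∀ k : ℕ, (k + 1 : ℂ) + -z ≠ 0) :
    deriv (bilateralMoment (r - 1) z) 0
      = ((r - 1).factorial : ℂ) / (2 * Real.pi * Complex.I) ^ (r - 1) * riemannZeta r
        - (-1) ^ (r - 1) * Real.pi * Complex.I * (z ^ r / r)
        - (-1) ^ (r - 1) * (z ^ (r - 1) / ((r : ℂ) - 1))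
        + (deriv (momentRemainder (r - 1) z (r + 1)) 0
          + (-1) ^ (r - 1) * deriv (momentRemainder (r - 1) (-z) (r + 1)) 0) := by
  obtain ⟨d, rfl⟩ : ∃ d, r = d + 2 := ⟨r - 2, by omega⟩
  rw [show d + 2 - 1 = d + 1 by omega]
  have hre : ((d + 1 : ℕ) : ℝ) + 1 - (d + 2 + 1 : ℕ) < (0 : ℂ).re := by
    push_cast
    simp
  rw [bilateralMoment,
    (eventuallyEq_glueHalfPlanes (bilateralMomentPart_succ (d + 1) z) hre).deriv_eq]
  have hterm : ∀ j : ℕ, HasDerivAt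
      (fun s => z ^ (j + 1) * (binomNeg (j + 1) s
        * twistedZeta (s + (j + 1 : ℕ) - (d + 1 : ℕ) - 1)))
      (z ^ (j + 1) * ((-1) ^ (j + 1) / (j + 1 : ℕ) * twistedZeta (j - (d + 1)))) 0 := fun j => by
    have h1 : DifferentiableAt ℂ
        (fun s : ℂ => twistedZeta (s + (j + 1 : ℕ) - (d + 1 : ℕ) - 1)) 0 :=
      (differentiable_twistedZeta.comp (((differentiable_id.add_const _).sub_const _).sub_const
        _)).differentiableAt
    have hz : binomNeg (j + 1) 0 = 0 := by simpa using binomNeg_eq_zero (Nat.succ_pos j)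
    convert! ((hasDerivAt_binomNeg_zero (Nat.succ_pos j)).mul h1.hasDerivAt).const_mul
      (z ^ (j + 1)) using 2
    rw [hz, zero_mul, add_zero, show (0 : ℂ) + (j + 1 : ℕ) - (d + 1 : ℕ) - 1 = j - (d + 1) by
      push_cast; ring]
  have hterm0 : HasDerivAt
      (fun s => z ^ 0 * (binomNeg 0 s * twistedZeta (s + (0 : ℕ) - (d + 1 : ℕ) - 1)))
      (((d + 1).factorial : ℂ) / (2 * Real.pi * Complex.I) ^ (d + 1)
        * riemannZeta ((d + 2 : ℕ) : ℂ)) 0 := by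
    have h := hasDerivAt_twistedZeta_neg_natCast hr
    have h1 : HasDerivAt twistedZeta (((d + 1).factorial : ℂ) / (2 * Real.pi * Complex.I) ^ (d + 1)
        * riemannZeta ((d + 2 : ℕ) : ℂ)) (0 + -((d + 2 : ℕ) : ℂ)) := by
      rw [zero_add]
      exact h
    convert! HasDerivAt.comp_add_const _ _ h1 using 1
    funext s
    rw [binomNeg_zero, pow_zero, one_mul, one_mul]
    congr 1
    push_cast
    ring
  have hR := (differentiableAt_momentRemainder (d + 1) z (d + 2 + 1) hre).hasDerivAt
  have hR' := (differentiableAt_momentRemainder (d + 1) (-z) (d + 2 + 1) hre).hasDerivAt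
  have hexp : DifferentiableAt ℂ
      (fun s : ℂ => (-1 : ℂ) ^ (d + 1) * Complex.exp (-(Real.pi * Complex.I * s))) 0 := by fun_prop
  have hR0 : momentRemainder (d + 1) (-z) (d + 2 + 1) 0 = 0 := by
    have := momentRemainder_one_sub_natCast (d + 1) hz le_rfl (show 1 ≤ d + 2 + 1 by omega)
    simpa using this
  have hsum : ∑ j ∈ Finset.range (d + 2), z ^ (j + 1) * ((-1) ^ (j + 1) / (j + 1 : ℕ)
      * twistedZeta (j - (d + 1)))
      = -((-1) ^ (d + 1) * Real.pi * Complex.I * (z ^ (d + 2) / (d + 2 : ℕ)))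
        - (-1) ^ (d + 1) * (z ^ (d + 1) / (((d + 2 : ℕ) : ℂ) - 1)) := by
    rw [Finset.sum_range_succ, Finset.sum_range_succ, Finset.sum_eq_zero fun j hj => ?_,
      show (((d + 1 : ℕ) : ℂ) - (d + 1)) = 0 by push_cast; ring,
      show (d : ℂ) - (d + 1) = -1 by ring, twistedZeta_zero, twistedZeta_neg_one,
      show (((d + 2 : ℕ) : ℂ) - 1) = (d + 1 : ℕ) by push_cast; ring]
    · ring
    · have hjd : j < d := Finset.mem_range.1 hj
      rw [show ((j : ℂ) - (d + 1)) = -((d + 1 - j : ℕ) : ℂ) by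
        push_cast [show j ≤ d + 1 by omega]; ring, twistedZeta_neg_natCast (by omega)]
      ring
  have hmain := ((HasDerivAt.fun_sum fun j (_ : j ∈ Finset.range (d + 2)) => hterm j).add
    hterm0).add (hR.add (hexp.hasDerivAt.mul hR'))
  have hpart : bilateralMomentPart (d + 1) z (d + 2 + 1) = _ :=
    funext fun s => by rw [bilateralMomentPart, Finset.sum_range_succ' _ (d + 2)]
  rw [hpart]
  refine hmain.deriv.trans ?_
  rw [hsum, hR0]
  simp only [mul_zero, neg_zero, Complex.exp_zero, mul_one, zero_add]
  ring

lemma mul_zpow_pow_eq (x y : ℂ) (ε : ℤ) (M : ℕ) :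
    (x * y ^ ε) ^ M = x ^ M * (y ^ M) ^ ε := by
  rw [mul_pow, ← zpow_natCast (y ^ ε), ← zpow_natCast y, ← zpow_mul, ← zpow_mul, mul_comm ε]

/-- The product defining the primitive multiple sine function, in terms of derivatives of the
remainders at `s = 0`. -/
lemma hasProd_primitiveSineFactor (r : ℕ) (hr : 1 ≤ r) {z : ℂ}
    (hz : ∀ k : ℕ, (k + 1 : ℂ) + z ≠ 0) (hz' : ∀ k : ℕ, (k + 1 : ℂ) + -z ≠ 0) :
    HasProd (fun k : ℕ => primitiveSineFactor r z (k + 1))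
      (Complex.exp (-deriv (momentRemainder (r - 1) (-z) (r + 1)) 0
        + (-1) ^ (r - 1) * -deriv (momentRemainder (r - 1) z (r + 1)) 0)) := by
  have hre : ((r - 1 : ℕ) : ℝ) + 1 - (r + 1 : ℕ) < (0 : ℂ).re := by
    push_cast [hr]
    simp
  have h := ((hasSum_deriv_momentRemainder (r - 1) (-z) (r + 1) hre).neg.add
    ((hasSum_deriv_momentRemainder (r - 1) z (r + 1) hre).neg.mul_left ((-1) ^ (r - 1)))).cexp
  convert! h using 1
  funext k
  have hε : ((-1 : ℂ) ^ (r - 1)) = (((-1 : ℤ) ^ (r - 1) : ℤ) : ℂ) := by push_cast; rfl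
  rw [Function.comp, Complex.exp_add, hε, Complex.exp_int_mul,
    exp_neg_deriv_momentTerm_zero _ (hz' k), exp_neg_deriv_momentTerm_zero _ (hz k), neg_neg,
    primitiveSineFactor, mul_zpow_pow_eq]
  push_cast
  rfl

/-- The generalized primitive sine function as a multiple of a power of the primitive sine
function. -/
theorem exp_neg_deriv_bilateralMoment_zero {r : ℕ} (hr : 2 ≤ r) {z : ℂ}
    (hz : ∀ k : ℕ, (k + 1 : ℂ) + z ≠ 0) (hz' : ∀ k : ℕ, (k + 1 : ℂ) + -z ≠ 0) :
    Complex.exp (-deriv (bilateralMoment (r - 1) z) 0)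
      = Complex.exp (-(((r - 1).factorial : ℂ) / (2 * Real.pi * Complex.I) ^ (r - 1)
            * riemannZeta r) + (-1) ^ (r - 1) * Real.pi * Complex.I * (z ^ r / r))
        * primitiveSine r z ^ ((-1 : ℤ) ^ (r - 1)) := by
  have hε : (((-1 : ℤ) ^ (r - 1) : ℤ) : ℂ) = (-1 : ℂ) ^ (r - 1) := by push_cast; rfl
  have hsq : (-1 : ℂ) ^ (r - 1) * (-1 : ℂ) ^ (r - 1) = 1 := by
    rw [← mul_pow]
    norm_num
  rw [primitiveSine, (hasProd_primitiveSineFactor r (by omega) hz hz').tprod_eq, ← Complex.exp_add,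
    ← Complex.exp_int_mul, ← Complex.exp_add, deriv_bilateralMoment_zero hr hz', hε]
  congr 1
  linear_combination (deriv (momentRemainder (r - 1) z (r + 1)) 0) * hsq

/-! ### The normalized multiple sine function -/

/-- Differentiating `K_r(s, z) = ζ_r(s, z) + (-1) ^ (r - 1) exp (-π i s) ζ_r(s, r - z)` at
`s = 1 - n`; the derivative of the exponential contributes the value `ζ_r(1 - n, r - z)`. -/
theorem exp_neg_deriv_bilateralKCont {r n : ℕ} (hr : 1 ≤ r) (hn : 1 ≤ n) {z : ℂ}
    (hz : 0 < z.im ∨ (z.im = 0 ∧ z.re < r)) :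
    Complex.exp (-deriv (bilateralKCont r z) (1 - n))
      = Complex.exp ((-1) ^ (r - 1) * Real.pi * Complex.I
          * (((n - 1).factorial : ℂ) / ((r + n - 1).factorial : ℂ))
          * multipleBernoulli r (r + n - 1) z)
        * Complex.exp (-deriv (zetaCont r z) (1 - n)
          + (-1) ^ (r + n - 1) * deriv (zetaCont r (r - z)) (1 - n)) := by
  have hmem := one_sub_natCast_mem_multipleHurwitzDomain r hn
  have heq := (eqOn_bilateralKCont hr hz).eventuallyEq_of_mem
    ((isOpen_multipleHurwitzDomain r).mem_nhds hmem)
  have hval := zetaCont_one_sub_natCast_eq_bernoulli r hn (a := r - z) fun k h => by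
    have := reflect_arg_condition hz k
    rw [h] at this
    simp at this
  rw [multipleBernoulli_sub] at hval
  obtain ⟨p, rfl⟩ : ∃ p, r = p + 1 := ⟨r - 1, by omega⟩
  obtain ⟨m, rfl⟩ : ∃ m, n = m + 1 := ⟨n - 1, by omega⟩
  have hE : Complex.exp (-(Real.pi * Complex.I * (1 - (m + 1 : ℕ)))) = (-1) ^ m := by
    rw [show -((Real.pi : ℂ) * Complex.I * (1 - (m + 1 : ℕ))) = -(-(Real.pi * Complex.I * m)) by
      push_cast; ring, Complex.exp_neg, exp_neg_pi_mul_I_mul_natCast, ← inv_pow]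
    norm_num
  have hEd : HasDerivAt (fun s : ℂ => (-1) ^ p * Complex.exp (-(Real.pi * Complex.I * s)))
      ((-1) ^ p * ((-1) ^ m * -(Real.pi * Complex.I))) (1 - (m + 1 : ℕ)) := by
    have h := (((hasDerivAt_id (1 - (m + 1 : ℕ) : ℂ)).const_mul
      (Real.pi * Complex.I)).neg.cexp).const_mul ((-1 : ℂ) ^ p)
    rw [← hE]
    simpa using! h
  have hd := (differentiableAt_zetaCont (p + 1) z hmem).hasDerivAt.add
    (hEd.mul (differentiableAt_zetaCont (p + 1) ((p + 1 : ℕ) - z) hmem).hasDerivAt)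
  rw [heq.deriv_eq]
  have hd' := hd.deriv
  rw [hE, hval] at hd'
  rw [← Complex.exp_add]
  congr 1
  refine (congrArg Neg.neg hd').trans ?_
  rw [Nat.add_sub_cancel, Nat.add_sub_cancel, show p + 1 + (m + 1) - 1 = p + m + 1 by omega]
  have h2 : (-1 : ℂ) ^ m * (-1) ^ m = 1 := by rw [← mul_pow]; norm_num
  have h3 : (-1 : ℂ) ^ p * (-1) ^ p = 1 := by rw [← mul_pow]; norm_num
  rw [pow_succ, pow_succ, pow_add]
  linear_combination ((-1) ^ p * Real.pi * Complex.I
    * ((m.factorial : ℂ) / ((p + m + 1).factorial : ℂ))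
    * multipleBernoulli (p + 1) (p + m + 1) z) * ((-1 : ℂ) ^ p * (-1) ^ p * h2 + h3)

theorem mainTheorem1 (r : ℕ) (hr : 2 ≤ r) :
    (∀ z : ℂ, (0 < z.im ∨ (z.im = 0 ∧ -1 < z.re ∧ z.re < 1)) →
      (∀ s : ℂ, (r : ℝ) < s.re → Summable (bilateralHTerm r z s)) ∧
      IsHolomorphicContinuation (bilateralHSeries r z) r Set.univ (bilateralH r z) ∧
      Multipliable (fun m : ℕ => primitiveSineFactor r z (m + 1)) ∧
      genPrimitiveSine r 1 z =
        Complex.exp (-(((r - 1).factorial : ℂ) / (2 * Real.pi * Complex.I) ^ (r - 1)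
              * riemannZeta r)
            + (-1) ^ (r - 1) * Real.pi * Complex.I * (z ^ r / r))
          * primitiveSine r z ^ ((-1 : ℤ) ^ (r - 1))) ∧
    (∀ n : ℕ, 1 ≤ n → ∀ z : ℂ,
      (0 < z.im ∨ (z.im = 0 ∧ 0 < z.re ∧ z.re < r) ∨ (1 < n ∧ z = 0)) →
      (∀ s : ℂ, (r : ℝ) < s.re →
        Summable (bilateralKTerm r z s) ∧
        Summable (multipleHurwitzTerm r z s) ∧
        Summable (multipleHurwitzTerm r (r - z) s)) ∧
      IsHolomorphicContinuation (bilateralKSeries r z) r Set.univ (bilateralK r z) ∧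
      IsHolomorphicContinuation (multipleHurwitzSeries r z) r (multipleHurwitzDomain r)
        (multipleHurwitz r z) ∧
      IsHolomorphicContinuation (multipleHurwitzSeries r (r - z)) r (multipleHurwitzDomain r)
        (multipleHurwitz r (r - z)) ∧
      genNormalizedSine r n z =
        Complex.exp ((-1) ^ (r - 1) * Real.pi * Complex.I
            * (((n - 1).factorial : ℂ) / ((r + n - 1).factorial : ℂ))
            * multipleBernoulli r (r + n - 1) z)
          * normalizedSine r n z) := by
  refine ⟨fun z hz => ?_, fun n hn z hz => ?_⟩
  · have hz1 : 0 < z.im ∨ (z.im = 0 ∧ z.re < 1) := hz.imp_right fun h => ⟨h.1, h.2.2⟩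
    have hcont := isHolomorphicContinuation_bilateralMoment hr hz1
    have hne : ∀ k : ℕ, (k + 1 : ℂ) + z ≠ 0 := fun k h => by
      have h1 := congrArg Complex.re h
      have h2 := congrArg Complex.im h
      have hk : (0 : ℝ) ≤ k := k.cast_nonneg
      simp at h1 h2
      rcases hz with h | ⟨_, h, _⟩ <;> linarith
    have hne' : ∀ k : ℕ, (k + 1 : ℂ) + -z ≠ 0 := fun k h => by
      have h1 := congrArg Complex.re h
      have h2 := congrArg Complex.im h
      have hk : (0 : ℝ) ≤ k := k.cast_nonneg
      simp at h1 h2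
      rcases hz with h | ⟨_, _, h⟩ <;> linarith
    have hH : bilateralH r z = bilateralMoment (r - 1) z :=
      Set.eqOn_univ _ _ |>.1 (hcont.eqOn_holomorphicContinuation isOpen_univ
        isPreconnected_univ (Set.subset_univ _))
    refine ⟨fun s hs => (hasSum_bilateralHTerm hr hz1 hs).summable,
      hcont.holomorphicContinuation,
      (hasProd_primitiveSineFactor r (by omega) hne hne').multipliable, ?_⟩
    rw [genPrimitiveSine, hH, Nat.cast_one, sub_self]
    exact exp_neg_deriv_bilateralMoment_zero hr hne hne'
  · have hr1 : 1 ≤ r := by omega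
    have hz1 : 0 < z.im ∨ (z.im = 0 ∧ z.re < r) := by
      rcases hz with h | ⟨h1, _, h2⟩ | ⟨_, rfl⟩
      · exact Or.inl h
      · exact Or.inr ⟨h1, h2⟩
      · exact Or.inr ⟨rfl, by simp; omega⟩
    have hcont := isHolomorphicContinuation_bilateralKCont hr1 hz1
    have hK : bilateralK r z = bilateralKCont r z :=
      Set.eqOn_univ _ _ |>.1 (hcont.eqOn_holomorphicContinuation isOpen_univ
        isPreconnected_univ (Set.subset_univ _))
    have hζ : ∀ a, deriv (multipleHurwitz r a) (1 - n) = deriv (zetaCont r a) (1 - n) := fun a =>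
      (((isHolomorphicContinuation_zetaCont r a).eqOn_holomorphicContinuation
        (isOpen_multipleHurwitzDomain r) (isPreconnected_multipleHurwitzDomain r)
        (halfPlane_subset_multipleHurwitzDomain r)).eventuallyEq_of_mem
        ((isOpen_multipleHurwitzDomain r).mem_nhds
          (one_sub_natCast_mem_multipleHurwitzDomain r hn))).deriv_eq
    refine ⟨fun s hs => ⟨(hasSum_bilateralKTerm hr1 hz1 hs).summable,
      (hasSum_multipleHurwitzTerm r z hs).summable,
      (hasSum_multipleHurwitzTerm r (r - z) hs).summable⟩, hcont.holomorphicContinuation,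
      (isHolomorphicContinuation_zetaCont r z).holomorphicContinuation,
      (isHolomorphicContinuation_zetaCont r (r - z)).holomorphicContinuation, ?_⟩
    rw [genNormalizedSine, normalizedSine, hK, hζ, hζ]
    exact exp_neg_deriv_bilateralKCont hr1 hn hz1
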